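/- **Conventions.** Let $(X,d)$ be a proper geodesic metric space with a basepoint $o$. A subset $Y\subseteq X$ is *contracting* if there is $C\ge 0$ such that every geodesic segment $\alpha$ with $d(\alpha,Y)\ge C$ satisfies $\mathrm{diam}(\pi_Y(\alpha))\le C$, where $\pi_Y(x)=\{y\in\overline Y: d(x,y)=d(x,Y)\}$ and $\pi_Y(\alpha)=\bigcup_{x\in\alpha}\pi_Y(x)$. Let a group $\Gamma$ act on $X$ by isometries. An element $g\in \Gamma$ is *contracting* if $\langle g\rangle o$ is a contracting subset and $n\mapsto g^n o$ is a quasi-isometric embedding $\mathbb Z\to X$. Two contracting elements $g,h$ are *weakly independent* if for every $r\ge 0$ the set $N_r(\langle g\rangle o)\cap N_r(\langle h\rangle o)$ has finite diameter, where $N_r$ denotes the closed $r$-neighbourhood. The action has the *contracting property* if $\Gamma$ contains two weakly independent contracting elements. The *stable translation length* is $\ell_d(g)=\lim_{n\to\infty} d(o,g^n o)/n$. The *horofunction compactification* $\overline X$ is the closure of $\{b_y: y\in X\}$, $b_y(x)=d(x,y)-d(o,y)$, in $C(X,\mathbb R)$ with the compact-open topology; $y\in X$ is identified with $b_y$. The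 *horofunction boundary* is $\partial_hX=\overline X\setminus X$, and $[\xi]$ denotes the class of $\xi\in\partial_h X$ under the relation of having bounded difference. A sequence $(x_n)$ in $X$ *accumulates at* $[\xi]$, written $[\lim x_n]=[\xi]$, if each of its accumulation points in $\overline X$ lies in $[\xi]$. For a contracting element $g$ let $[g_X^+]=[\lim_{n\to+\infty} g^n o]$. For $K\le \Gamma$ let $[\Lambda_X K]=\{[\xi]:\xi\in\overline{Ko}\cap\partial_hX\}$. **Theorem 1.8.** Let a group $G$ act by isometries, with the contracting property, on each of two proper geodesic metric spaces $(X_1,d_1)$ and $(X_2,d_2)$ with basepoints $o_1\in X_1$, $o_2\in X_2$. (The actions may be proper, but need not be.) Let $H\le G$ be a subgroup such that 1. the actions of $H$ on $X_1$ and on $X_2$ have the contracting property; 2. $H$ is geometrically dense: $[\Lambda_{X_i}H]=[\Lambda_{X_i}G]$ for $i=1,2$; 3. (Extension Condition) for every $g\in G$ that is contracting on both $X_1$ and $X_2$ there is a sequence $(h_n)$ in $H$ such that $[\lim h_no_1]=[g^+_{X_1}]$ and $[\lim h_no_2]=[g^+_{X_2}]$. Then $G$ has marked length spectrum rigidity from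 $H$: if $\ell_{d_1}(h)=\ell_{d_2}(h)$ for all $h\in H$, then $$\sup_{g,g'\in G}\bigl|d_1(go_1,g'o_1)-d_2(go_2,g'o_2)\bigr|<+\infty .$$ -/

import Mathlib

open Filter Topology
open scoped NNReal

namespace MLSR

/-! ### Geodesics, projections and contracting subsets -/

section Metric

variable {X : Type*} [MetricSpace X]

/-- `γ` restricted to `[0, L]` is a geodesic segment of length `L`. -/
def IsGeodesicSegment (γ : ℝ → X) (L : ℝ) : Prop :=
  0 ≤ L ∧ ∀ s ∈ Set.Icc 0 L, ∀ t ∈ Set.Icc 0 L, dist (γ s) (γ t) = |s - t|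

variable (X) in
/-- Any two points are joined by a geodesic segment. -/
def IsGeodesicSpace : Prop :=
  ∀ x y : X, ∃ (γ : ℝ → X) (L : ℝ), IsGeodesicSegment γ L ∧ γ 0 = x ∧ γ L = y

/-- Closest point projection of a point `x` to `A` (set-valued, with values in the closure). -/
def proj (A : Set X) (x : X) : Set X :=
  {y | y ∈ closure A ∧ dist x y = Metric.infDist x A}

/-- Closest point projection of a set `B` to `A`. -/
def projSet (A B : Set X) : Set X := ⋃ x ∈ B, proj A x

/-- `Y` is `C`-contracting: a geodesic segment `α` with `d(α, Y) ≥ C` has a projection to `Y` of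
diameter at most `C`. -/
def IsContractingWith (C : ℝ) (Y : Set X) : Prop :=
  ∀ (γ : ℝ → X) (L : ℝ), IsGeodesicSegment γ L →
    (∀ t ∈ Set.Icc 0 L, ∀ y ∈ Y, C ≤ dist (γ t) y) →
    ∀ p ∈ projSet Y (γ '' Set.Icc 0 L), ∀ q ∈ projSet Y (γ '' Set.Icc 0 L), dist p q ≤ C

/-- `Y` is a contracting subset. -/
def IsContracting (Y : Set X) : Prop := ∃ C : ℝ, 0 ≤ C ∧ IsContractingWith C Y

/-- `Y` and `Z` have `R`-bounded intersection for some gauge `R : [0, ∞) → [0, ∞)`: the diameter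
of `N_r(Y) ∩ N_r(Z)` is at most `R r` for all `r ≥ 0`, where `N_r` is the closed
`r`-neighbourhood. -/
def HaveBoundedIntersection (Y Z : Set X) : Prop :=
  ∃ R : ℝ≥0 → ℝ≥0, ∀ r : ℝ≥0,
    ∀ x ∈ Metric.cthickening r Y ∩ Metric.cthickening r Z,
    ∀ y ∈ Metric.cthickening r Y ∩ Metric.cthickening r Z, dist x y ≤ R r

end Metric

/-! ### Contracting elements and stable translation length -/

section Action

variable {X : Type*} [MetricSpace X] {G : Type*} [Group G] [MulAction G X]

/-- The orbit `⟨g⟩ o`. -/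
def cyclicOrbit (o : X) (g : G) : Set X := Set.range fun n : ℤ => g ^ n • o

/-- `g` is a contracting element: `⟨g⟩ o` is a contracting subset and `n ↦ g ^ n o` is a
quasi-isometric embedding of `ℤ`. -/
def IsContractingElement (o : X) (g : G) : Prop :=
  IsContracting (cyclicOrbit o g) ∧
    ∃ k c : ℝ, 1 ≤ k ∧ 0 ≤ c ∧ ∀ m n : ℤ,
      1 / k * |(m : ℝ) - n| - c ≤ dist (g ^ m • o) (g ^ n • o) ∧
        dist (g ^ m • o) (g ^ n • o) ≤ k * |(m : ℝ) - n| + c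

/-- `g` and `h` are weakly independent contracting elements. -/
def WeaklyIndependent (o : X) (g h : G) : Prop :=
  IsContractingElement o g ∧ IsContractingElement o h ∧
    HaveBoundedIntersection (cyclicOrbit o g) (cyclicOrbit o h)

variable (G) in
/-- The action of `G` on `X` has the contracting property: there are two weakly independent
contracting elements in `G`. -/
def HasContractingProperty (o : X) : Prop := ∃ g h : G, WeaklyIndependent o g h

/-- The stable translation length `lim d(o, g ^ n o) / n`. -/
noncomputable def stableLength (o : X) (g : G) : ℝ :=
  limUnder atTop fun n : ℕ => dist o (g ^ n • o) / (n : ℝ)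

/-- For an isometric action the limit defining the stable translation length exists. -/
theorem tendsto_stableLength [IsIsometricSMul G X] (o : X) (g : G) :
    Tendsto (fun n : ℕ => dist o (g ^ n • o) / (n : ℝ)) atTop (𝓝 (stableLength o g)) := by
  have hs : Subadditive fun n : ℕ => dist o (g ^ n • o) := by
    intro m n
    calc dist o (g ^ (m + n) • o)
        ≤ dist o (g ^ m • o) + dist (g ^ m • o) (g ^ (m + n) • o) := dist_triangle _ _ _
      _ = dist o (g ^ m • o) + dist o (g ^ n • o) := by rw [pow_add, mul_smul, dist_smul]
  have hb : BddBelow (Set.range fun n : ℕ => dist o (g ^ n • o) / (n : ℝ)) := by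
    refine ⟨0, ?_⟩
    rintro _ ⟨n, rfl⟩
    positivity
  exact tendsto_nhds_limUnder ⟨_, hs.tendsto_lim hb⟩

end Action

/-! ### The horofunction boundary -/

section Horo

variable {X : Type*} [MetricSpace X]

/-- The function `b_y(x) = d(x, y) - d(o, y)`. -/
def busemann (o y : X) : C(X, ℝ) where
  toFun x := dist x y - dist o y
  continuous_toFun := by fun_prop

/-- The horofunction compactification: the closure of `{b_y}` in the compact-open topology
(the topology that Mathlib puts on `C(X, ℝ)`). A point `y` of `X` is identified with `b_y`. -/
def horoClosure (o : X) : Set C(X, ℝ) := closure (Set.range (busemann o))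

/-- The horofunction boundary. -/
def horoBoundary (o : X) : Set C(X, ℝ) := horoClosure o \ Set.range (busemann o)

/-- Two horofunctions are equivalent if their difference is bounded. -/
def finiteDifference (o : X) : Setoid (horoBoundary o) where
  r ξ η := ∃ K : ℝ, ∀ x : X, |ξ.1 x - η.1 x| ≤ K
  iseqv :=
    { refl := fun ξ => ⟨0, fun x => by simp⟩
      symm := fun {ξ η} ⟨K, hK⟩ => ⟨K, fun x => by rw [abs_sub_comm]; exact hK x⟩
      trans := fun {ξ η ζ} ⟨K, hK⟩ ⟨L, hL⟩ =>
        ⟨K + L, fun x => (abs_sub_le _ (η.1 x) _).trans (add_le_add (hK x) (hL x))⟩ }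

/-- The reduced horofunction boundary. -/
def ReducedHoroBoundary (o : X) : Type _ := Quotient (finiteDifference o)

/-- The class `[ξ]` of a horofunction `ξ`. -/
def horoClass (o : X) (ξ : horoBoundary o) : ReducedHoroBoundary o :=
  Quotient.mk (finiteDifference o) ξ

/-- `f` is an accumulation point of the sequence `x` in the horofunction compactification. -/
def IsAccumulationPoint (o : X) (x : ℕ → X) (f : C(X, ℝ)) : Prop :=
  MapClusterPt f atTop fun n => busemann o (x n)

/-- The classes of those accumulation points of the sequence `x` that lie in the horofunction
boundary. -/
def limitClasses (o : X) (x : ℕ → X) : Set (ReducedHoroBoundary o) :=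
  {Ξ | ∃ ξ : horoBoundary o, IsAccumulationPoint o x ξ.1 ∧ horoClass o ξ = Ξ}

/-- Every accumulation point of the sequence `x` in the horofunction compactification lies in the
horofunction boundary, and its class belongs to `S`. For `S = {[ξ]}` this says that `x`
accumulates at `[ξ]`. -/
def AccumulatesIn (o : X) (x : ℕ → X) (S : Set (ReducedHoroBoundary o)) : Prop :=
  ∀ f : C(X, ℝ), IsAccumulationPoint o x f →
    ∃ hf : f ∈ horoBoundary o, horoClass o ⟨f, hf⟩ ∈ S

variable {G : Type*} [Group G] [MulAction G X]

/-- The attracting point `[g⁺] = [lim g ^ n o]`. It is recorded as the set of the classes of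
accumulation points of `g ^ n o` as `n → +∞`; for a contracting element of a proper geodesic space
this set has exactly one element. -/
def attractingPoint (o : X) (g : G) : Set (ReducedHoroBoundary o) :=
  limitClasses o fun n => g ^ n • o

/-- The limit set `[Λ K]` of a subgroup: the classes of the horofunctions in the closure of
the orbit `K o`. -/
def limitSet (o : X) (K : Subgroup G) : Set (ReducedHoroBoundary o) :=
  horoClass o '' {ξ | ξ.1 ∈ closure (Set.range fun k : K => busemann o (k • o))}

end Horo

/-! ### Pairs of actions -/

section Pair

variable {G : Type*} [Group G]
  {X₁ : Type*} [MetricSpace X₁] [MulAction G X₁]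
  {X₂ : Type*} [MetricSpace X₂] [MulAction G X₂]

/-- `SC(G)`: the elements that are contracting on both spaces. -/
def simultaneouslyContracting (G : Type*) [Group G] [MulAction G X₁] [MulAction G X₂]
    (o₁ : X₁) (o₂ : X₂) : Set G :=
  {g | IsContractingElement o₁ g ∧ IsContractingElement o₂ g}

/-- `H` has the same limit set as `G` in both reduced horofunction boundaries. -/
def GeometricallyDense (o₁ : X₁) (o₂ : X₂) (H : Subgroup G) : Prop :=
  limitSet o₁ H = limitSet o₁ (⊤ : Subgroup G) ∧ limitSet o₂ H = limitSet o₂ (⊤ : Subgroup G)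

/-- For each simultaneously contracting `g` some sequence `h` in `H` satisfies
`[lim h_n o₁] = [g⁺]` in the first boundary and `[lim h_n o₂] = [g⁺]` in the second. -/
def ExtensionCondition (o₁ : X₁) (o₂ : X₂) (H : Subgroup G) : Prop :=
  ∀ g ∈ simultaneouslyContracting G o₁ o₂, ∃ h : ℕ → H,
    AccumulatesIn o₁ (fun n => h n • o₁) (attractingPoint o₁ g) ∧
      AccumulatesIn o₂ (fun n => h n • o₂) (attractingPoint o₂ g)

/-- The two actions have the same marked length spectrum on `E`. -/
def SameMLSOn (o₁ : X₁) (o₂ : X₂) (E : Set G) : Prop :=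
  ∀ g ∈ E, stableLength o₁ g = stableLength o₂ g

/-- `G` has marked length spectrum rigidity from `E`: if the marked length spectra agree on `E`
then `|d₁(g o₁, h o₁) - d₂(g o₂, h o₂)|` is bounded over all `g, h` in `G`. -/
def MLSRigidityFrom (o₁ : X₁) (o₂ : X₂) (E : Set G) : Prop :=
  SameMLSOn o₁ o₂ E →
    ∃ C : ℝ, ∀ g h : G, |dist (g • o₁) (h • o₁) - dist (g • o₂) (h • o₂)| ≤ C

end Pair

end MLSR

/-! Write |g|ᵢ for `dist oᵢ (g • oᵢ)`. The core is a comparison principle, `exists_abs_dist_sub_le`: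
if a group acts on both spaces with the contracting property and stable lengths agree on the
elements that are tame in both, then |g|₁ - |g|₂ is bounded. Indeed, inserting factors from a fixed
finite list turns any g into a simultaneously tame t with |g|ᵢ - C ≤ ℓᵢ(t) ≤ |t|ᵢ ≤ |g|ᵢ + C
(`IsAxisFamily.exists_isTame`). The principle is applied to `H`, where lengths agree by assumption,
and then to `G`.

Between the two, `ExtensionCondition.stableLength_eq` carries equality of lengths from `H` to every
simultaneously tame s in `G`. Choose a tame f transverse to s. The Gromov product at the basepoint
of s⁺ and s^m f⁺ is |s^m| up to an error independent of m. Sequences x, y in `H` accumulate at these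
two points in both spaces, and the Gromov product of x o and y o involves only |x|, |y| and |x⁻¹y|,
which are comparable on `H`. So |s^m|₁ - |s^m|₂ is bounded in m, and dividing by m gives equal
lengths.

Contracting sets enter only through the equivalent property `Bottleneck`. The axes available in the
two spaces come from unrelated elements; a counting argument on cyclic permutations of one word
(`IsAxisFamily.exists_isTransverse`) makes a single element tame in both. -/

namespace MLSR

/-! ### Approximate projections and the bottleneck property -/

section Bottleneck

variable {X : Type*} [MetricSpace X]

/-- `p ∈ A` is, up to an error `1`, a closest point of `A` to `x`. -/
def NearProj (A : Set X) (x p : X) : Prop := p ∈ A ∧ ∀ a ∈ A, dist x p ≤ dist x a + 1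

/-- Two points of `X` whose near projections to `A` are more than `K` apart are joined
efficiently, up to an error `K`, by the path through these projections. -/
def Bottleneck (K : ℝ) (A : Set X) : Prop :=
  ∀ x y p q, NearProj A x p → NearProj A y q →
    dist p q ≤ K ∨ dist x p + dist p q + dist q y ≤ dist x y + K

/-- All near projections of `x` to `A` are at distance at most `τ` from `c`. -/
def ProjWithin (A : Set X) (x c : X) (τ : ℝ) : Prop := ∀ p, NearProj A x p → dist c p ≤ τ

theorem exists_nearProj {A : Set X} (hA : A.Nonempty) (x : X) : ∃ p, NearProj A x p := by
  obtain ⟨p, hp, h⟩ := (Metric.infDist_lt_iff hA).1 (lt_add_one (Metric.infDist x A))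
  exact ⟨p, hp, fun a ha => h.le.trans (by linarith [Metric.infDist_le_dist_of_mem (x := x) ha])⟩

theorem NearProj.self {A : Set X} {p : X} (hp : p ∈ A) : NearProj A p p :=
  ⟨hp, fun a _ => by rw [dist_self]; positivity⟩

theorem ProjWithin.mono {A : Set X} {x c : X} {τ σ : ℝ} (h : ProjWithin A x c τ) (hτ : τ ≤ σ) :
    ProjWithin A x c σ := fun p hp => (h p hp).trans hτ

theorem Bottleneck.mono {A : Set X} {K K' : ℝ} (h : Bottleneck K A) (hK : K ≤ K') :
    Bottleneck K' A := fun x y p q hp hq =>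
  (h x y p q hp hq).imp (fun h => h.trans hK) (fun h => by linarith)

/-- Near projections of `x` to `A` lie, coarsely, between `x` and all points of `A`. -/
theorem Bottleneck.between {A : Set X} {K : ℝ} (h : Bottleneck K A) (hK : 0 ≤ K) {x p a : X}
    (hp : NearProj A x p) (ha : a ∈ A) : dist x p + dist p a ≤ dist x a + K + 1 := by
  rcases h x a p a hp (NearProj.self ha) with h | h
  · linarith [hp.2 a ha]
  · rw [dist_self] at h; linarith

/-- The point `e` acts as a gate: a path from `x` to `y` must follow `A` up to the projection of
`y`, which is near `e`. Applied to well-chosen gates, this is the source of all the ping-pong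
estimates. -/
theorem Bottleneck.escape {A : Set X} {K σ : ℝ} (h : Bottleneck K A) (hA : A.Nonempty) {x y e : X}
    (hx : ¬ ProjWithin A x e (K + σ)) (hy : ProjWithin A y e σ) :
    dist x e + dist e y ≤ dist x y + K + 2 * σ := by
  unfold ProjWithin at hx
  push Not at hx
  obtain ⟨p, hp, hpe⟩ := hx
  obtain ⟨q, hq⟩ := exists_nearProj hA y
  have h1 := hy q hq
  have h2 := dist_triangle e q p
  have h3 := dist_comm p q
  rcases h x y p q hp hq with h | h
  · linarith
  · linarith [dist_triangle x p q, dist_triangle x q e, dist_triangle e q y, dist_comm e q]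

theorem not_projWithin {A : Set X} (hA : A.Nonempty) {x c e : X} {τ σ : ℝ}
    (hx : ProjWithin A x c τ) (h : τ + σ < dist c e) : ¬ ProjWithin A x e σ := fun h' => by
  obtain ⟨p, hp⟩ := exists_nearProj hA x
  linarith [hx p hp, h' p hp, dist_triangle c p e, dist_comm e p]

/-- Replacing `A` by a set at finite Hausdorff distance preserves the bottleneck property. -/
theorem Bottleneck.of_close {A B : Set X} {K r : ℝ} (h : Bottleneck K A) (hK : 0 ≤ K) (hr : 0 ≤ r)
    (hAB : ∀ a ∈ A, ∃ b ∈ B, dist a b ≤ r) (hBA : ∀ b ∈ B, ∃ a ∈ A, dist b a ≤ r) :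
    Bottleneck (5 * K + 20 * r + 20) B := by
  have key : ∀ x p, NearProj B x p → ∃ p', NearProj A x p' ∧ dist p p' ≤ K + 3 * r + 2 := by
    intro x p hp
    obtain ⟨a, ha, hpa⟩ := hBA p hp.1
    obtain ⟨p', hp'⟩ := exists_nearProj ⟨a, ha⟩ x
    refine ⟨p', hp', ?_⟩
    obtain ⟨b, hb, hpb⟩ := hAB p' hp'.1
    have h1 := h.between hK hp' ha
    linarith [hp.2 b hb, dist_triangle x p' b, dist_triangle x p a, dist_triangle p a p',
      dist_comm a p']
  intro x y p q hp hq
  obtain ⟨p', hp', hpp⟩ := key x p hp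
  obtain ⟨q', hq', hqq⟩ := key y q hq
  rcases h x y p' q' hp' hq' with h | h
  · left
    linarith [dist_triangle p p' q, dist_triangle p' q' q, dist_comm q q']
  · right
    linarith [dist_triangle p p' q, dist_triangle p' q' q, dist_comm q q',
      dist_triangle x p' p, dist_comm p p', dist_triangle q q' y]

end Bottleneck

/-! ### Contracting sets and the bottleneck property -/

section Contracting

variable {X : Type*} [MetricSpace X]

theorem IsGeodesicSegment.sub {γ : ℝ → X} {L s t : ℝ} (h : IsGeodesicSegment γ L) (hs : 0 ≤ s)
    (hst : s ≤ t) (ht : t ≤ L) : IsGeodesicSegment (fun u => γ (s + u)) (t - s) :=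
  ⟨by linarith, fun u hu v hv => by
    rw [h.2 (s + u) ⟨by linarith [hu.1], by linarith [hu.2]⟩ (s + v)
      ⟨by linarith [hv.1], by linarith [hv.2]⟩]
    congr 1; ring⟩

theorem IsGeodesicSegment.continuousOn {γ : ℝ → X} {L : ℝ} (h : IsGeodesicSegment γ L) :
    ContinuousOn γ (Set.Icc 0 L) := by
  have : LipschitzOnWith 1 γ (Set.Icc 0 L) := LipschitzOnWith.of_dist_le_mul fun s hs t ht => by
    rw [h.2 s hs t ht, Real.dist_eq]; simp
  exact this.continuousOn

theorem exists_mem_proj [ProperSpace X] {Y : Set X} (hY : Y.Nonempty) (x : X) :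
    ∃ p, p ∈ proj Y x := by
  obtain ⟨p, hp, h⟩ := isClosed_closure.exists_infDist_eq_dist hY.closure x
  exact ⟨p, hp, by rw [← h, Metric.infDist_closure]⟩

theorem mem_proj_self {Y : Set X} {y : X} (hy : y ∈ Y) : y ∈ proj Y y :=
  ⟨subset_closure hy, by rw [dist_self, Metric.infDist_zero_of_mem hy]⟩

theorem IsContractingWith.exact_bottleneck [ProperSpace X] (hX : IsGeodesicSpace X) {Y : Set X}
    (hY : Y.Nonempty) {C : ℝ} (hC : 0 ≤ C) (h : IsContractingWith C Y) {x y p q : X}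
    (hp : p ∈ proj Y x) (hq : q ∈ proj Y y) :
    dist p q ≤ C ∨ dist x p + dist p q + dist q y ≤ dist x y + 8 * C := by
  obtain ⟨γ, L, hγ, rfl, rfl⟩ := hX x y
  have hL := hγ.1
  set S : Set ℝ := {t ∈ Set.Icc 0 L | Metric.infDist (γ t) Y ≤ C} with hS
  -- The contracting property on subsegments that stay at distance at least `C` from `Y`.
  have hfar : ∀ s t, 0 ≤ s → s ≤ t → t ≤ L → (∀ u ∈ Set.Icc s t, C ≤ Metric.infDist (γ u) Y) →
      ∀ a ∈ proj Y (γ s), ∀ b ∈ proj Y (γ t), dist a b ≤ C := by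
    intro s t hs hst ht hu a ha b hb
    refine h _ _ (hγ.sub hs hst ht) (fun u hu' y hy => ?_) a ?_ b ?_
    · exact (hu _ ⟨by linarith [hu'.1], by linarith [hu'.2]⟩).trans
        (Metric.infDist_le_dist_of_mem hy)
    · exact Set.mem_biUnion (x := γ s) ⟨0, ⟨le_rfl, by linarith⟩, by simp⟩ ha
    · exact Set.mem_biUnion (x := γ t) ⟨t - s, ⟨by linarith, le_rfl⟩, by simp⟩ hb
  rcases S.eq_empty_or_nonempty with hemp | hne
  · left
    refine hfar 0 L le_rfl hL le_rfl (fun u hu => ?_) p hp q hq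
    by_contra hlt
    exact (hemp ▸ (⟨hu, (not_le.1 hlt).le⟩ : u ∈ S) : u ∈ (∅ : Set ℝ))
  have hcont : ContinuousOn (fun t => Metric.infDist (γ t) Y) (Set.Icc 0 L) :=
    (Metric.continuous_infDist_pt Y).comp_continuousOn hγ.continuousOn
  have hSc : IsCompact S :=
    isCompact_Icc.of_isClosed_subset
      (hcont.preimage_isClosed_of_isClosed isClosed_Icc isClosed_Iic) (fun t ht => ht.1)
  obtain ⟨s, hs, hsmin⟩ := hSc.exists_isLeast hne
  obtain ⟨t, ht, htmax⟩ := hSc.exists_isGreatest hne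
  have hst : s ≤ t := hsmin ht
  -- Before the first and after the last parameter of `S` the distance exceeds `C` only on an open
  -- interval; continuity adds the endpoint, so `hfar` reaches `γ s` and `γ t`.
  have hcl : ∀ a b, 0 ≤ a → a < b → b ≤ L → (∀ u ∈ Set.Ioo a b, C ≤ Metric.infDist (γ u) Y) →
      ∀ u ∈ Set.Icc a b, C ≤ Metric.infDist (γ u) Y := by
    intro a b ha hab hb hu u hu'
    have : ContinuousOn (fun t => Metric.infDist (γ t) Y) (closure (Set.Ioo a b)) := by
      rw [closure_Ioo hab.ne]
      exact hcont.mono (Set.Icc_subset_Icc ha hb)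
    refine le_on_closure (f := fun _ => C) hu continuousOn_const this ?_
    rwa [closure_Ioo hab.ne]
  have hps : dist p (γ s) ≤ 2 * C := by
    rcases hs.1.1.eq_or_lt with h0 | h0
    · rw [← h0, dist_comm, hp.2]
      have := hs.2
      rw [← h0] at this
      linarith
    · obtain ⟨r, hr⟩ := exists_mem_proj hY (γ s)
      have := hfar 0 s le_rfl h0.le hs.1.2 (hcl 0 s le_rfl h0 hs.1.2 fun u hu => by
        by_contra hlt
        exact absurd (hsmin ⟨⟨hu.1.le, hu.2.le.trans hs.1.2⟩, (not_le.1 hlt).le⟩)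
          (not_le.2 hu.2)) p hp r hr
      linarith [dist_triangle p r (γ s), dist_comm r (γ s), hr.2, hs.2]
  have hqt : dist q (γ t) ≤ 2 * C := by
    rcases ht.1.2.eq_or_lt with h0 | h0
    · rw [h0, dist_comm, hq.2]
      have := ht.2
      rw [h0] at this
      linarith
    · obtain ⟨r, hr⟩ := exists_mem_proj hY (γ t)
      have := hfar t L ht.1.1 h0.le le_rfl (hcl t L ht.1.1 h0 le_rfl fun u hu => by
        by_contra hlt
        exact absurd (htmax ⟨⟨ht.1.1.trans hu.1.le, hu.2.le⟩, (not_le.1 hlt).le⟩)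
          (not_le.2 hu.1)) r hr q hq
      linarith [dist_triangle q r (γ t), dist_comm r (γ t), hr.2, ht.2, dist_comm q r]
  -- Since `p` and `q` are `2 * C`-close to `γ s` and `γ t`, detouring through them costs 2C + 4C +
  -- 2C.
  right
  have h0 : (0 : ℝ) ∈ Set.Icc 0 L := ⟨le_rfl, hL⟩
  have hL' : L ∈ Set.Icc 0 L := ⟨hL, le_rfl⟩
  have e1 := hγ.2 0 h0 s hs.1
  have e2 := hγ.2 s hs.1 t ht.1
  have e3 := hγ.2 t ht.1 L hL'
  have e4 := hγ.2 0 h0 L hL'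
  rw [abs_sub_comm, abs_of_nonneg (by linarith [hs.1.1])] at e1
  rw [abs_sub_comm, abs_of_nonneg (by linarith)] at e2
  rw [abs_sub_comm, abs_of_nonneg (by linarith [ht.1.2])] at e3
  rw [abs_sub_comm, abs_of_nonneg (by linarith)] at e4
  linarith [dist_triangle (γ 0) (γ s) p, dist_triangle p (γ s) q, dist_triangle (γ s) (γ t) q,
    dist_triangle q (γ t) (γ L), dist_comm p (γ s), dist_comm q (γ t)]

theorem IsContracting.exists_bottleneck [ProperSpace X] (hX : IsGeodesicSpace X) {Y : Set X}
    (hY : Y.Nonempty) (h : IsContracting Y) : ∃ K, 0 ≤ K ∧ Bottleneck K Y := by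
  obtain ⟨C, hC, h⟩ := h
  have key : ∀ x p p', p' ∈ proj Y x → NearProj Y x p → dist p' p ≤ 8 * C + 1 := by
    intro x p p' hp' hp
    have h1 : dist x p - 1 ≤ Metric.infDist x Y :=
      (Metric.le_infDist hY).2 fun y hy => by linarith [hp.2 y hy]
    rcases h.exact_bottleneck hX hY hC hp' (mem_proj_self hp.1) with h | h
    · linarith
    · rw [dist_self] at h
      linarith [hp'.2]
  refine ⟨40 * C + 4, by positivity, fun x y p q hp hq => ?_⟩
  obtain ⟨p', hp'⟩ := exists_mem_proj hY x
  obtain ⟨q', hq'⟩ := exists_mem_proj hY y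
  have h1 := key x p p' hp' hp
  have h2 := key y q q' hq' hq
  have h3 := dist_triangle p p' q
  have h4 := dist_triangle p' q' q
  have h5 := dist_comm p p'
  rcases h.exact_bottleneck hX hY hC hp' hq' with h | h
  · left; linarith
  · right
    linarith [dist_triangle x p' p, dist_triangle q q' y, dist_comm q q']

/-- If two projections were far apart, an efficient path would run through them. The point of the
geodesic as far along as the first projection would then be close to `Y`, contrary to the assumption
on the geodesic. -/
theorem Bottleneck.isContracting {Y : Set X} (hY : Y.Nonempty) {K : ℝ} (hK : 0 ≤ K)
    (h : Bottleneck K Y) : IsContracting Y := by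
  have key : ∀ x p, p ∈ proj Y x → ∃ p', NearProj Y x p' ∧ dist p p' ≤ 1 / 2 := by
    intro x p hp
    obtain ⟨p', hp', hd⟩ := Metric.mem_closure_iff.1 hp.1 (1 / 2) (by norm_num)
    exact ⟨p', ⟨hp', fun a ha => by
      linarith [Metric.infDist_le_dist_of_mem (x := x) ha, hp.2, dist_triangle x p p']⟩, hd.le⟩
  refine ⟨2 * K + 1, by positivity, fun γ L hγ hfar => ?_⟩
  have main : ∀ s ∈ Set.Icc 0 L, ∀ t ∈ Set.Icc 0 L, s ≤ t → ∀ p ∈ proj Y (γ s), ∀ q ∈ proj Y (γ t),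
      dist p q ≤ 2 * K + 1 := by
    intro s hs t ht hst p hp q hq
    obtain ⟨p', hp', hpp⟩ := key _ p hp
    obtain ⟨q', hq', hqq⟩ := key _ q hq
    suffices dist p' q' ≤ 2 * K by
      linarith [dist_triangle p p' q, dist_triangle p' q' q, dist_comm q q']
    by_contra! hlt
    rcases h _ _ _ _ hp' hq' with h1 | h1
    · linarith
    have est := hγ.2 s hs t ht
    rw [abs_sub_comm, abs_of_nonneg (by linarith)] at est
    set u := s + dist (γ s) p' with hu
    have hsu : s ≤ u := by linarith [dist_nonneg (x := γ s) (y := p')]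
    have hut : u ≤ t := by linarith [dist_nonneg (x := q') (y := γ t)]
    have huI : u ∈ Set.Icc 0 L := ⟨hs.1.trans hsu, hut.trans ht.2⟩
    have esu := hγ.2 s hs u huI
    have eut := hγ.2 u huI t ht
    rw [abs_sub_comm, abs_of_nonneg (by linarith)] at esu
    rw [abs_sub_comm, abs_of_nonneg (by linarith)] at eut
    obtain ⟨r, hr⟩ := exists_nearProj hY (γ u)
    have hf := hfar u huI r hr.1
    have h2 : dist p' r ≤ K := by
      rcases h _ _ _ _ hp' hr with h2 | h2
      · exact h2
      · linarith [dist_comm r (γ u), dist_nonneg (x := p') (y := r)]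
    rcases h _ _ _ _ hr hq' with h3 | h3
    · linarith [dist_triangle p' r q']
    · linarith [dist_triangle p' r q', dist_triangle (γ s) p' (γ t), dist_triangle p' q' (γ t)]
  intro p hp q hq
  obtain ⟨_, ⟨s, hs, rfl⟩, hp⟩ := Set.mem_iUnion₂.1 hp
  obtain ⟨_, ⟨t, ht, rfl⟩, hq⟩ := Set.mem_iUnion₂.1 hq
  rcases le_total s t with hst | hst
  · exact main s hs t ht hst p hp q hq
  · rw [dist_comm]
    exact main t ht s hs hst q hq p hp

end Contracting

/-! ### Equivariance and cyclic orbits -/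

section Equivariance

open scoped Pointwise

variable {X : Type*} [MetricSpace X] {G : Type*} [Group G] [MulAction G X]

section Orbit

variable {X : Type*} [MulAction G X]

theorem cyclicOrbit_nonempty (o : X) (t : G) : (cyclicOrbit o t).Nonempty := ⟨_, 0, rfl⟩

theorem pow_smul_mem (o : X) (t : G) (i : ℕ) : t ^ i • o ∈ cyclicOrbit o t := ⟨i, by simp⟩

theorem self_mem_cyclicOrbit (o : X) (t : G) : o ∈ cyclicOrbit o t := ⟨0, by simp⟩

theorem zpow_smul_cyclicOrbit (o : X) (t : G) (i : ℤ) :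
    t ^ i • cyclicOrbit o t = cyclicOrbit o t := by
  ext x
  constructor
  · rintro ⟨_, ⟨j, rfl⟩, rfl⟩
    exact ⟨i + j, by simp [smul_smul, zpow_add]⟩
  · rintro ⟨j, rfl⟩
    exact ⟨t ^ (j - i) • o, ⟨j - i, rfl⟩, by simp [smul_smul, ← zpow_add]⟩

end Orbit

variable [IsIsometricSMul G X]

theorem dist_inv_smul (f : G) (x y : X) : dist (f⁻¹ • x) y = dist x (f • y) := by
  rw [← dist_smul f, smul_inv_smul]

theorem NearProj.smul {A : Set X} {x p : X} (h : NearProj A x p) (f : G) :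
    NearProj (f • A) (f • x) (f • p) := by
  refine ⟨Set.smul_mem_smul_set h.1, ?_⟩
  rintro _ ⟨a, ha, rfl⟩
  simpa only [dist_smul] using h.2 a ha

theorem ProjWithin.smul {A : Set X} {x c : X} {τ : ℝ} (h : ProjWithin A x c τ) (f : G) :
    ProjWithin (f • A) (f • x) (f • c) τ := by
  intro p hp
  have := hp.smul f⁻¹
  rw [inv_smul_smul, inv_smul_smul] at this
  have h' := h _ this
  rwa [← dist_smul f c, smul_inv_smul] at h'

theorem Bottleneck.smul {A : Set X} {K : ℝ} (h : Bottleneck K A) (f : G) :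
    Bottleneck K (f • A) := by
  intro x y p q hp hq
  have hp' := hp.smul f⁻¹
  have hq' := hq.smul f⁻¹
  rw [inv_smul_smul] at hp' hq'
  simpa only [dist_smul] using h _ _ _ _ hp' hq'

theorem NearProj.zpow_smul {o : X} {t : G} {x p : X} (h : NearProj (cyclicOrbit o t) x p) (i : ℤ) :
    NearProj (cyclicOrbit o t) (t ^ i • x) (t ^ i • p) := by
  simpa only [zpow_smul_cyclicOrbit] using h.smul (t ^ i)

theorem dist_zpow_smul (o : X) (t : G) (i j : ℤ) :
    dist (t ^ i • o) (t ^ j • o) = dist o (t ^ (j - i) • o) := by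
  rw [← dist_smul (t ^ i) o, smul_smul, ← zpow_add, add_sub_cancel]

theorem dist_neg_zpow_smul (o : X) (t : G) (i : ℤ) :
    dist o (t ^ (-i) • o) = dist o (t ^ i • o) := by
  rw [zpow_neg, dist_comm, dist_inv_smul]

theorem dist_zpow_smul_natAbs (o : X) (t : G) (i : ℤ) :
    dist o (t ^ i • o) = dist o (t ^ i.natAbs • o) := by
  rcases Int.natAbs_eq i with h | h
  · conv_lhs => rw [h]
    rw [zpow_natCast]
  · conv_lhs => rw [h]
    rw [dist_neg_zpow_smul, zpow_natCast]

theorem dist_pow_smul_le (o : X) (t : G) (n : ℕ) : dist o (t ^ n • o) ≤ n * dist o (t • o) := by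
  induction n with
  | zero => simp
  | succ n ih =>
    have h := dist_triangle o (t ^ n • o) (t ^ (n + 1) • o)
    rw [pow_succ, mul_smul, dist_smul, ← mul_smul, ← pow_succ] at h
    push_cast
    linarith

end Equivariance

/-! ### Elements with a tame axis -/

section Tame

open scoped Pointwise

variable {X : Type*} [MetricSpace X] {G : Type*} [Group G] [MulAction G X]

/-- The orbit `n ↦ t ^ n o` has the bottleneck property, is coarsely geodesic, and grows at least
at the linear rate `l`. -/
structure IsTame (o : X) (t : G) (l : ℝ) : Prop where
  bott : ∃ K, 0 ≤ K ∧ Bottleneck K (cyclicOrbit o t)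
  morse : ∃ D, 0 ≤ D ∧ ∀ m n : ℕ,
    dist o (t ^ m • o) + dist o (t ^ n • o) ≤ dist o (t ^ (m + n) • o) + D
  growth : ∃ c, ∀ m : ℕ, m * l - c ≤ dist o (t ^ m • o)

theorem IsTame.tendsto {o : X} {t : G} {l : ℝ} (h : IsTame o t l) (hl : 0 < l) :
    Tendsto (fun n : ℕ => dist o (t ^ n • o)) atTop atTop := by
  obtain ⟨c, hc⟩ := h.growth
  refine tendsto_atTop_mono hc ?_
  exact tendsto_atTop_add_const_right _ _ (tendsto_natCast_atTop_atTop.atTop_mul_const hl)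

variable [IsIsometricSMul G X]

theorem IsTame.le_stableLength {o : X} {t : G} {l : ℝ} (h : IsTame o t l) :
    l ≤ stableLength o t := by
  obtain ⟨c, hc⟩ := h.growth
  have h1 : Tendsto (fun n : ℕ => l - c / n) atTop (𝓝 (l - 0)) :=
    tendsto_const_nhds.sub (tendsto_const_div_atTop_nhds_zero_nat c)
  rw [sub_zero] at h1
  refine le_of_tendsto_of_tendsto h1 (tendsto_stableLength o t) ?_
  filter_upwards [eventually_gt_atTop 0] with n hn
  have hn' : (0 : ℝ) < n := by exact_mod_cast hn
  rw [le_div_iff₀ hn', sub_mul, div_mul_cancel₀ _ hn'.ne']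
  linarith [hc n]

theorem stableLength_le (o : X) (t : G) : stableLength o t ≤ dist o (t • o) := by
  refine le_of_tendsto (tendsto_stableLength o t) ?_
  filter_upwards [eventually_gt_atTop 0] with n hn
  have hn' : (0 : ℝ) < n := by exact_mod_cast hn
  rw [div_le_iff₀ hn']
  linarith [dist_pow_smul_le o t n]

theorem IsTame.isContractingElement {o : X} {t : G} {l : ℝ} (h : IsTame o t l) (hl : 0 < l) :
    IsContractingElement o t := by
  obtain ⟨K, hK, hb⟩ := h.bott
  obtain ⟨c, hc⟩ := h.growth
  refine ⟨hb.isContracting (cyclicOrbit_nonempty o t) hK,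
    max (max 1 (1 / l)) (dist o (t • o)), max 0 c, ?_, ?_, fun m n => ?_⟩
  · exact (le_max_left _ _).trans (le_max_left _ _)
  · exact le_max_left _ _
  have e : (((n - m).natAbs : ℕ) : ℝ) = |(m : ℝ) - n| := by
    rw [Nat.cast_natAbs, abs_sub_comm]; push_cast; rfl
  rw [dist_zpow_smul, dist_zpow_smul_natAbs, ← e]
  set N := (n - m).natAbs
  have hN : (0 : ℝ) ≤ N := by positivity
  constructor
  · have : 1 / max (max 1 (1 / l)) (dist o (t • o)) ≤ l := by
      rw [one_div_le (by positivity) hl]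
      exact (le_max_right _ _).trans (le_max_left _ _)
    linarith [hc N, mul_le_mul_of_nonneg_right this hN, le_max_right 0 c]
  · have := mul_le_mul_of_nonneg_right
      (le_max_right (max 1 (1 / l)) (dist o (t • o))) hN
    linarith [dist_pow_smul_le o t N, le_max_left 0 c]

theorem abs_dist_conj_sub_le (o : X) (c s : G) :
    |dist o ((c * s * c⁻¹) • o) - dist o (s • o)| ≤ 2 * dist o (c • o) := by
  have h1 : dist o ((c * s * c⁻¹) • o) = dist (c⁻¹ • o) (s • c⁻¹ • o) := by
    rw [dist_inv_smul, smul_smul, smul_smul, mul_assoc]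
  have h2 : dist (c⁻¹ • o) o = dist o (c • o) := dist_inv_smul c o o
  have h3 : dist (s • c⁻¹ • o) (s • o) = dist o (c • o) := by rw [dist_smul, h2]
  rw [h1, abs_le]
  constructor
  · linarith [dist_triangle o (c⁻¹ • o) (s • o), dist_triangle (c⁻¹ • o) (s • c⁻¹ • o) (s • o),
      dist_comm o (c⁻¹ • o)]
  · linarith [dist_triangle (c⁻¹ • o) o (s • c⁻¹ • o), dist_triangle o (s • o) (s • c⁻¹ • o),
      dist_comm (s • o) (s • c⁻¹ • o)]

/-- Conjugation changes only additive constants; the rate `l` survives. -/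
theorem IsTame.conj {o : X} {t : G} {l : ℝ} (h : IsTame o t l) (c : G) :
    IsTame o (c * t * c⁻¹) l := by
  have key : ∀ n : ℕ, |dist o ((c * t * c⁻¹) ^ n • o) - dist o (t ^ n • o)| ≤
      2 * dist o (c • o) := fun n => by
    rw [conj_pow]; exact abs_dist_conj_sub_le o c _
  refine ⟨?_, ?_, ?_⟩
  · obtain ⟨K, hK, hb⟩ := h.bott
    have e : ∀ i : ℤ, dist (c • t ^ i • o) ((c * t * c⁻¹) ^ i • o) = dist o (c • o) := by
      intro i
      rw [conj_zpow, mul_smul, mul_smul, dist_smul, dist_smul, dist_comm, dist_inv_smul]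
    refine ⟨_, ?_, (hb.smul c).of_close hK (dist_nonneg (x := o) (y := c • o)) ?_ ?_⟩
    · positivity
    · rintro _ ⟨_, ⟨i, rfl⟩, rfl⟩
      exact ⟨_, ⟨i, rfl⟩, (e i).le⟩
    · rintro _ ⟨i, rfl⟩
      exact ⟨c • t ^ i • o, ⟨_, ⟨i, rfl⟩, rfl⟩, by rw [dist_comm]; exact (e i).le⟩
  · obtain ⟨D, hD, h⟩ := h.morse
    refine ⟨D + 6 * dist o (c • o), by positivity, fun m n => ?_⟩
    linarith [h m n, (abs_le.1 (key m)).2, (abs_le.1 (key n)).2, (abs_le.1 (key (m + n))).1]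
  · obtain ⟨d, h⟩ := h.growth
    exact ⟨d + 2 * dist o (c • o), fun m => by linarith [h m, (abs_le.1 (key m)).1]⟩

theorem IsTame.exists_morse {o : X} {t : G} {l : ℝ} (h : IsTame o t l) : ∃ D, 0 ≤ D ∧
    ∀ i j k : ℤ, i ≤ j → j ≤ k → dist (t ^ i • o) (t ^ j • o) + dist (t ^ j • o) (t ^ k • o) ≤
      dist (t ^ i • o) (t ^ k • o) + D := by
  obtain ⟨D, hD, h⟩ := h.morse
  refine ⟨D, hD, fun i j k hij hjk => ?_⟩
  have := h (j - i).toNat (k - j).toNat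
  simp only [← zpow_natCast, Nat.cast_add, Int.toNat_of_nonneg (sub_nonneg.2 hij),
    Int.toNat_of_nonneg (sub_nonneg.2 hjk)] at this
  rw [dist_zpow_smul, dist_zpow_smul, dist_zpow_smul]
  convert this using 5
  ring

end Tame

/-! ### Concatenation along a bottleneck set -/

section Concatenation

open scoped Pointwise

variable {X : Type*} [MetricSpace X] {G : Type*} [Group G] [MulAction G X]

/-- The concatenation of a long translation `f` along the bottleneck set `A` with a
displacement `g` transverse to `A`. -/
structure IsTransverse (o : X) (A : Set X) (K τ : ℝ) (f g : G) : Prop where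
  K_nonneg : 0 ≤ K
  τ_nonneg : 0 ≤ τ
  bott : Bottleneck K A
  nonempty : A.Nonempty
  smul_eq : f • A = A
  base : ProjWithin A o o τ
  fwd : ProjWithin A (g • o) o τ
  bwd : ProjWithin A (g⁻¹ • o) o τ
  far : K + 2 * τ < dist o (g • o)
  long : 10 * K + 10 * τ + 1 ≤ dist o (f • o)

variable [IsIsometricSMul G X] {o : X} {A : Set X} {K τ : ℝ} {f g : G}

namespace IsTransverse

theorem inv (h : IsTransverse o A K τ f g) : IsTransverse o A K τ f⁻¹ g⁻¹ where
  K_nonneg := h.K_nonneg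
  τ_nonneg := h.τ_nonneg
  bott := h.bott
  nonempty := h.nonempty
  smul_eq := by rw [inv_smul_eq_iff, h.smul_eq]
  base := h.base
  fwd := h.bwd
  bwd := by rw [inv_inv]; exact h.fwd
  far := by rw [dist_comm, dist_inv_smul]; exact h.far
  long := by rw [dist_comm, dist_inv_smul]; exact h.long

theorem projWithin_base (h : IsTransverse o A K τ f g) : ProjWithin A (f • o) (f • o) τ := by
  simpa only [h.smul_eq] using h.base.smul f

theorem projWithin_mul (h : IsTransverse o A K τ f g) : ProjWithin A ((f * g) • o) (f • o) τ := by
  simpa only [h.smul_eq, mul_smul] using h.fwd.smul f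

theorem dist_smul_mul (f g : G) (o : X) : dist (f • o) ((f * g) • o) = dist o (g • o) := by
  rw [mul_smul, dist_smul]

/-- A path that arrives at `A` near `o` passes near `f o` on the way to `f g o`. -/
theorem path (h : IsTransverse o A K τ f g) {y : X} (hy : ProjWithin A y o (K + τ)) :
    dist y (f • o) + dist (f • o) ((f * g) • o) ≤ dist y ((f * g) • o) + K + 2 * τ :=
  h.bott.escape h.nonempty
    (not_projWithin h.nonempty hy (by linarith [h.long, h.K_nonneg, h.τ_nonneg]))
    h.projWithin_mul

/-- The ping-pong step. If it failed, a path from `y` to `f o` would pass near `f g o`, while by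
`path` one from `y` to `f g o` passes near `f o`; this forces the displacement of `g` below the
bound `far`. -/
theorem projWithin_inv_smul (h : IsTransverse o A K τ f g) {y : X}
    (hy : ProjWithin A y o (K + τ)) : ProjWithin A ((f * g)⁻¹ • y) o (K + τ) := by
  by_contra hn
  have h1 := h.bott.escape h.nonempty hn h.bwd
  rw [dist_inv_smul, dist_inv_smul, smul_smul, mul_assoc, mul_inv_cancel, mul_one] at h1
  have h4 : dist o (g⁻¹ • o) = dist o (g • o) := by rw [dist_comm, dist_inv_smul]
  have h2 := h.path hy
  have h3 := dist_smul_mul f g o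
  linarith [h.far, dist_comm (f • o) ((f * g) • o)]

theorem projWithin_inv_pow_smul (h : IsTransverse o A K τ f g) {y : X}
    (hy : ProjWithin A y o (K + τ)) (i : ℕ) :
    ProjWithin A (((f * g)⁻¹) ^ i • y) o (K + τ) := by
  induction i with
  | zero => simpa using hy
  | succ i ih =>
    rw [pow_succ', mul_smul]
    exact h.projWithin_inv_smul ih

theorem projWithin_inv_pow (h : IsTransverse o A K τ f g) (i : ℕ) :
    ProjWithin A (((f * g)⁻¹) ^ i • o) o (K + τ) :=
  h.projWithin_inv_pow_smul (h.base.mono (by linarith [h.K_nonneg])) i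

theorem projWithin_pow (h : IsTransverse o A K τ f g) (i : ℕ) :
    ProjWithin A ((f * g) ^ (i + 1) • o) (f • o) (K + τ) := by
  -- Ping-pong for the inverse pair concerns powers of `g * f`, and f (g f)^i g = (f g)^(i+1).
  have h1 := (h.inv.projWithin_inv_pow_smul (h.fwd.mono (by linarith [h.K_nonneg])) i).smul f
  rw [h.smul_eq, smul_smul, smul_smul] at h1
  convert h1 using 2
  have : (f⁻¹ * g⁻¹)⁻¹ = f⁻¹ * (f * g) * f⁻¹⁻¹ := by group
  rw [this, conj_pow, pow_succ]
  group

/-- Seen from (f g)^(-i) o, the points o, f o, f g o come in this order up to a total error 4K + 4τ,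
which the length of `f` absorbs. -/
theorem growth_succ (h : IsTransverse o A K τ f g) (i : ℕ) :
    dist o ((f * g) ^ i • o) + (dist o (g • o) + 1) ≤ dist o ((f * g) ^ (i + 1) • o) := by
  have hK := h.K_nonneg
  have hτ := h.τ_nonneg
  have hy := h.projWithin_inv_pow i
  have h1 := h.path hy
  have h2 := h.bott.escape h.nonempty (e := o)
    (not_projWithin h.nonempty h.projWithin_base (by rw [dist_comm]; linarith [h.long])) hy
  rw [dist_comm (f • o) o, dist_comm (f • o)] at h2
  rw [dist_smul_mul] at h1
  rw [inv_pow] at h1 h2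
  rw [dist_inv_smul] at h2
  rw [dist_inv_smul ((f * g) ^ i) o ((f * g) • o), smul_smul, ← pow_succ] at h1
  rw [dist_comm o (((f * g) ^ i)⁻¹ • o), dist_inv_smul] at h2
  rw [dist_inv_smul] at h1
  linarith [h.long]

theorem growth (h : IsTransverse o A K τ f g) (i : ℕ) :
    i * (dist o (g • o) + 1) ≤ dist o ((f * g) ^ i • o) := by
  induction i with
  | zero => simp
  | succ i ih => push_cast; linarith [h.growth_succ i]

theorem le_growth (h : IsTransverse o A K τ f g) (i : ℕ) : (i : ℝ) ≤ dist o ((f * g) ^ i • o) := by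
  have := h.growth i
  have : (0 : ℝ) ≤ i * dist o (g • o) := by positivity
  linarith

/-- Positive powers project to `A` near `f o`, negative ones near `o`, so `o` lies coarsely between
them. -/
theorem morse (h : IsTransverse o A K τ f g) (m n : ℕ) :
    dist o ((f * g) ^ m • o) + dist o ((f * g) ^ n • o) ≤
      dist o ((f * g) ^ (m + n) • o) + (3 * K + 2 * τ) := by
  have hK := h.K_nonneg
  have hτ := h.τ_nonneg
  rcases n with _ | n
  · simp; positivity
  have h2 := h.bott.escape h.nonempty (e := o)
    (not_projWithin h.nonempty (h.projWithin_pow n) (by rw [dist_comm]; linarith [h.long]))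
    (h.projWithin_inv_pow m)
  have e1 : dist o (((f * g) ^ m)⁻¹ • o) = dist o ((f * g) ^ m • o) := by
    rw [dist_comm, dist_inv_smul]
  have e2 : dist ((f * g) ^ (n + 1) • o) (((f * g) ^ m)⁻¹ • o) =
      dist o ((f * g) ^ (m + (n + 1)) • o) := by
    rw [dist_comm, dist_inv_smul, smul_smul, ← pow_add]
  rw [inv_pow] at h2
  linarith [dist_comm o ((f * g) ^ (n + 1) • o)]

/-- Otherwise an efficient path from `x` to its near projection on the orbit would pass `o` long
before, making `o` a much closer orbit point. -/
theorem projWithin_of_nearProj_neg (h : IsTransverse o A K τ f g) {x : X} {i : ℕ}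
    (hx : NearProj (cyclicOrbit o (f * g)) x ((f * g) ^ (-(i : ℤ)) • o))
    (hi : 3 * K + 2 * τ + 1 < i) : ProjWithin A x o (K + (K + τ)) := by
  by_contra hn
  have hy := h.projWithin_inv_pow i
  have h1 := h.bott.escape h.nonempty hn hy
  rw [← zpow_natCast, inv_zpow'] at h1
  have h2 := hx.2 o (self_mem_cyclicOrbit _ _)
  rw [dist_neg_zpow_smul, zpow_natCast] at h1
  linarith [h.le_growth i]

theorem projWithin_of_nearProj_pos (h : IsTransverse o A K τ f g) {x : X} {i : ℕ}
    (hx : NearProj (cyclicOrbit o (f * g)) x ((f * g) ^ (i + 1) • o))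
    (hi : 2 * dist o (g • o) + 3 * K + 2 * τ + 1 < i) :
    ProjWithin A x (f • o) (K + (K + τ)) := by
  by_contra hn
  have h1 := h.bott.escape h.nonempty hn (h.projWithin_pow i)
  -- The gate `f o` need not be on the orbit; f g o replaces it at the cost of the displacement of
  -- `g`.
  have h2 := hx.2 ((f * g) • o) (by simpa using pow_smul_mem o (f * g) 1)
  have h3 := dist_triangle x (f • o) ((f * g) • o)
  have h4 := dist_triangle ((f * g) • o) (f • o) ((f * g) ^ (i + 1) • o)
  have h5 := dist_smul_mul f g o
  have h6 := dist_comm (f • o) ((f * g) • o)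
  have h7 : dist ((f * g) • o) ((f * g) ^ (i + 1) • o) = dist o ((f * g) ^ i • o) := by
    rw [pow_succ', mul_smul (f * g), dist_smul]
  linarith [h.le_growth i]

/-- After translation by `(f * g) ^ (-j)`, the points `x` and `y` project to `A` near `o` and near
`f o` respectively, so `o` is a gate. -/
theorem through (h : IsTransverse o A K τ f g) {k : ℕ}
    (hk : 2 * dist o (g • o) + 3 * K + 2 * τ + 1 < k) {x y : X} {a b j : ℤ}
    (hx : NearProj (cyclicOrbit o (f * g)) x ((f * g) ^ a • o))
    (hy : NearProj (cyclicOrbit o (f * g)) y ((f * g) ^ b • o))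
    (ha : a + k ≤ j) (hb : j + k + 1 ≤ b) :
    dist x ((f * g) ^ j • o) + dist ((f * g) ^ j • o) y ≤ dist x y + (5 * K + 2 * τ) := by
  have hK := h.K_nonneg
  have hτ := h.τ_nonneg
  have hx' := hx.zpow_smul (-j)
  have hy' := hy.zpow_smul (-j)
  rw [smul_smul, ← zpow_add] at hx' hy'
  obtain ⟨m, hm⟩ := Int.eq_ofNat_of_zero_le (a := -(-j + a)) (by omega)
  obtain ⟨n, hn⟩ := Int.eq_ofNat_of_zero_le (a := -j + b - 1) (by omega)
  have hm' : (k : ℝ) ≤ m := by exact_mod_cast (show (k : ℤ) ≤ m by omega)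
  have hn' : (k : ℝ) ≤ n := by exact_mod_cast (show (k : ℤ) ≤ n by omega)
  rw [show -j + a = -(m : ℤ) by omega] at hx'
  rw [show -j + b = ((n + 1 : ℕ) : ℤ) by push_cast; omega, zpow_natCast] at hy'
  have h1 := h.projWithin_of_nearProj_neg hx' (by linarith [dist_nonneg (x := o) (y := g • o)])
  have h2 := h.projWithin_of_nearProj_pos hy' (by linarith)
  have h3 := h.bott.escape h.nonempty (e := o)
    (not_projWithin h.nonempty h2 (by rw [dist_comm]; linarith [h.long])) h1
  rw [dist_smul, zpow_neg, dist_inv_smul, dist_comm o, dist_inv_smul] at h3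
  linarith [dist_comm x y, dist_comm y ((f * g) ^ j • o)]

theorem bottleneck (h : IsTransverse o A K τ f g) :
    ∃ K', 0 ≤ K' ∧ Bottleneck K' (cyclicOrbit o (f * g)) := by
  have hK := h.K_nonneg
  have hτ := h.τ_nonneg
  obtain ⟨k, hk⟩ := exists_nat_gt (2 * dist o (g • o) + 3 * K + 2 * τ + 1)
  set t := f * g with ht
  set w := dist o (t • o) with hw
  have hw0 : 0 ≤ w := dist_nonneg
  have hwk : 0 ≤ k * w := by positivity
  refine ⟨2 * (5 * K + 2 * τ) + 4 * k * w + 2 * w, by positivity, ?_⟩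
  have main : ∀ (x y : X) (a b : ℤ), NearProj (cyclicOrbit o t) x (t ^ a • o) →
      NearProj (cyclicOrbit o t) y (t ^ b • o) → a ≤ b →
      dist (t ^ a • o) (t ^ b • o) ≤ 2 * (5 * K + 2 * τ) + 4 * k * w + 2 * w ∨
      dist x (t ^ a • o) + dist (t ^ a • o) (t ^ b • o) + dist (t ^ b • o) y ≤
        dist x y + (2 * (5 * K + 2 * τ) + 4 * k * w + 2 * w) := by
    intro x y a b hp hq hab
    by_cases hlt : b - a < 2 * k + 1
    · left
      rw [dist_zpow_smul, dist_zpow_smul_natAbs]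
      have h1 := dist_pow_smul_le o t (b - a).natAbs
      have h2 : ((b - a).natAbs : ℝ) ≤ 2 * k := by
        exact_mod_cast (show ((b - a).natAbs) ≤ 2 * k by omega)
      have h3 := mul_le_mul_of_nonneg_right h2 hw0
      linarith
    · right
      push Not at hlt
      -- The path is pinned at the orbit points `k` steps after `a` and `k + 1` steps before `b`;
      -- moving to the ends costs a bounded amount.
      have h1 := h.through hk hp hq (j := a + k) le_rfl (by omega)
      have h2 := h.through hk (NearProj.self hp.1) hq (j := b - k - 1) (by omega) (by omega)
      rw [← ht] at h1 h2
      have h3 : dist (t ^ a • o) (t ^ (a + k) • o) ≤ k * w := by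
        rw [dist_zpow_smul, add_sub_cancel_left, zpow_natCast]
        exact dist_pow_smul_le o t k
      have h4 : dist (t ^ (b - k - 1) • o) (t ^ b • o) ≤ k * w + w := by
        rw [dist_zpow_smul, show b - (b - k - 1) = ((k + 1 : ℕ) : ℤ) by push_cast; ring,
          zpow_natCast]
        refine (dist_pow_smul_le o t (k + 1)).trans ?_
        push_cast
        linarith
      linarith [dist_triangle x (t ^ (a + k) • o) (t ^ a • o),
        dist_triangle (t ^ a • o) (t ^ (a + k) • o) y, dist_comm (t ^ a • o) (t ^ (a + k) • o),
        dist_triangle (t ^ a • o) (t ^ (b - k - 1) • o) (t ^ b • o),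
        dist_triangle (t ^ b • o) (t ^ (b - k - 1) • o) y,
        dist_comm (t ^ b • o) (t ^ (b - k - 1) • o)]
  intro x y p q hp hq
  obtain ⟨a, rfl⟩ := hp.1
  obtain ⟨b, rfl⟩ := hq.1
  rcases le_total a b with hab | hab
  · exact main x y a b hp hq hab
  · refine (main y x b a hq hp hab).imp (fun h => by rw [dist_comm]; exact h) fun h => ?_
    simp only at h ⊢
    linarith [dist_comm (t ^ a • o) (t ^ b • o), dist_comm x y, dist_comm x (t ^ a • o),
      dist_comm y (t ^ b • o)]

theorem isTame (h : IsTransverse o A K τ f g) : IsTame o (f * g) (dist o (g • o) + 1) :=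
  ⟨h.bottleneck, ⟨_, by have := h.K_nonneg; have := h.τ_nonneg; positivity, h.morse⟩,
    ⟨0, fun m => by rw [sub_zero]; exact h.growth m⟩⟩

end IsTransverse

end Concatenation

/-! ### Families of transverse axes -/

section AxisFamily

open scoped Pointwise

variable {X : Type*} [MetricSpace X] {G : Type*} [Group G] [MulAction G X]

/-- A finite family of bottleneck sets `A j`, each with an unbounded translation `a j`, such that
every point projects close to the basepoint on all of them with at most one exception. -/
structure IsAxisFamily {N : ℕ} (o : X) (K τ : ℝ) (A : Fin N → Set X) (a : Fin N → G) : Prop where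
  K_nonneg : 0 ≤ K
  τ_nonneg : 0 ≤ τ
  bott : ∀ j, Bottleneck K (A j)
  nonempty : ∀ j, (A j).Nonempty
  smul_eq : ∀ j, a j • A j = A j
  unbounded : ∀ j, Tendsto (fun n : ℕ => dist o (a j ^ n • o)) atTop atTop
  base : ∀ j, ProjWithin (A j) o o τ
  dichotomy : ∀ x i j, i ≠ j → ProjWithin (A i) x o τ ∨ ProjWithin (A j) x o τ

theorem IsAxisFamily.pow_smul_eq {N : ℕ} {o : X} {K τ : ℝ} {A : Fin N → Set X} {a : Fin N → G}
    (h : IsAxisFamily o K τ A a) (j : Fin N) (n : ℕ) : a j ^ n • A j = A j := by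
  induction n with
  | zero => simp
  | succ n ih => rw [pow_succ, mul_smul, h.smul_eq, ih]

theorem IsAxisFamily.exists_pow {N : ℕ} {o : X} {K τ : ℝ} {A : Fin N → Set X} {a : Fin N → G}
    (h : IsAxisFamily o K τ A a) (L : ℝ) : ∃ n : ℕ, ∀ j, L ≤ dist o (a j ^ n • o) :=
  (eventually_all.2 fun j => (h.unbounded j).eventually_ge_atTop L).exists

theorem HaveBoundedIntersection.exists_projWithin {A B : Set X} {o : X} {K : ℝ} (hK : 0 ≤ K)
    (hA : Bottleneck K A) (hB : Bottleneck K B) (hoA : o ∈ A) (hoB : o ∈ B)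
    (h : HaveBoundedIntersection A B) : ∃ σ, 0 ≤ σ ∧ ∀ b ∈ B, ProjWithin A b o σ := by
  obtain ⟨R, hR⟩ := h
  set r : ℝ≥0 := ⟨3 * K + 3, by positivity⟩ with hr
  refine ⟨R r, (R r).2, fun b hb p hp => ?_⟩
  obtain ⟨q, hq⟩ := exists_nearProj ⟨b, hb⟩ p
  have h1 := hA.between hK hp hoA
  have h2 := hB.between hK hq hoB
  have h3 := hB.between hK hq hb
  -- Summing `h1`, `h2` and `h3` against the triangle inequality for `b`, `q`, `o` bounds `2 * dist
  -- p q`. So `p` and `o` both lie in the two neighbourhoods.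
  have h4 : dist p q ≤ r := by
    change dist p q ≤ 3 * K + 3
    linarith [dist_triangle b q o, dist_comm b q, dist_comm b p]
  refine hR r o ⟨?_, ?_⟩ p ⟨?_, ?_⟩
  · exact Metric.self_subset_cthickening _ hoA
  · exact Metric.self_subset_cthickening _ hoB
  · exact Metric.self_subset_cthickening _ hp.1
  · exact Metric.mem_cthickening_of_dist_le p q _ _ hq.1 h4

theorem IsContractingElement.tendsto_dist {o : X} {g : G} (h : IsContractingElement o g) :
    Tendsto (fun n : ℕ => dist o (g ^ n • o)) atTop atTop := by
  obtain ⟨-, k, c, hk, -, h⟩ := h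
  refine tendsto_atTop_mono (f := fun n : ℕ => 1 / k * (n : ℝ) + (-c)) (fun n => ?_) ?_
  · have := (h 0 n).1
    simp only [Int.cast_zero, zero_sub, Int.cast_natCast, abs_neg, Nat.abs_cast, zpow_zero,
      one_smul, zpow_natCast] at this
    linarith
  · exact tendsto_atTop_add_const_right _ _
      (tendsto_natCast_atTop_atTop.const_mul_atTop (by positivity))

theorem IsContractingElement.exists_separated {o : X} {g : G} (h : IsContractingElement o g)
    (R : ℝ) : ∃ M : ℕ, ∀ i j : ℕ, i ≠ j → R < dist (g ^ (M * i) • o) (g ^ (M * j) • o) := by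
  obtain ⟨-, k, c, hk, -, h⟩ := h
  obtain ⟨M, hM⟩ := exists_nat_gt ((R + c) * k)
  refine ⟨M, fun i j hij => ?_⟩
  have := (h (M * i : ℕ) (M * j : ℕ)).1
  rw [zpow_natCast, zpow_natCast] at this
  refine lt_of_lt_of_le ?_ this
  have h1 : (1 : ℝ) ≤ |(i : ℝ) - j| := by
    exact_mod_cast Int.one_le_abs (sub_ne_zero.2 (Nat.cast_injective.ne hij))
  push_cast
  rw [← mul_sub, abs_mul, Nat.abs_cast, lt_sub_iff_add_lt, one_div, ← div_eq_inv_mul,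
    lt_div_iff₀ (by linarith)]
  nlinarith [Nat.cast_nonneg (α := ℝ) M]

variable [IsIsometricSMul G X]

/-- The family consists of translates of the axis of `h` by widely spaced powers of `g`. A point
projecting far from `o` on the `j`-th translate must project to the axis of `g` near `u j • o`,
which can happen for only one `j`. -/
theorem HasContractingProperty.exists_isAxisFamily [ProperSpace X] (hX : IsGeodesicSpace X) {o : X}
    (h : HasContractingProperty G o) (N : ℕ) :
    ∃ (K τ : ℝ) (A : Fin N → Set X) (a : Fin N → G), IsAxisFamily o K τ A a := by
  obtain ⟨g, h, hg, hh, hgh⟩ := h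
  obtain ⟨K₁, hK₁, hA⟩ := hg.1.exists_bottleneck hX (cyclicOrbit_nonempty o g)
  obtain ⟨K₂, hK₂, hB⟩ := hh.1.exists_bottleneck hX (cyclicOrbit_nonempty o h)
  set A := cyclicOrbit o g
  set B := cyclicOrbit o h
  set K := max K₁ K₂
  have hK : 0 ≤ K := hK₁.trans (le_max_left _ _)
  replace hA : Bottleneck K A := hA.mono (le_max_left _ _)
  replace hB : Bottleneck K B := hB.mono (le_max_right _ _)
  have hoB : o ∈ B := self_mem_cyclicOrbit o h
  obtain ⟨σ, hσ, hproj⟩ := hgh.exists_projWithin hK hA hB (self_mem_cyclicOrbit o g) hoB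
  obtain ⟨M, hM⟩ := hg.exists_separated (2 * (K + σ))
  set u : Fin N → G := fun j => g ^ (M * (j : ℕ))
  have huA : ∀ j, u j • A = A := fun j => by
    simpa only [zpow_natCast] using zpow_smul_cyclicOrbit o g (M * (j : ℕ) : ℕ)
  obtain ⟨W, hW⟩ := Finset.exists_le (Finset.univ.image fun j => dist o (u j • o))
  replace hW : ∀ j, dist o (u j • o) ≤ max 0 W := fun j =>
    (hW _ (Finset.mem_image_of_mem _ (Finset.mem_univ j))).trans (le_max_right _ _)
  refine ⟨K, max 0 W + K + 2 * σ + 1, fun j => u j • B, fun j => u j * h * (u j)⁻¹, hK,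
    by positivity, fun j => hB.smul _, fun j => ⟨u j • o, Set.smul_mem_smul_set hoB⟩,
    fun j => ?_, fun j => ?_, fun j p hp => ?_, fun x i j hij => ?_⟩
  · have := zpow_smul_cyclicOrbit o h 1
    rw [zpow_one] at this
    rw [smul_smul, inv_mul_cancel_right, mul_smul, this]
  · have : Tendsto (fun n : ℕ => dist o (h ^ n • o) + -(2 * dist o (u j • o))) atTop atTop :=
      tendsto_atTop_add_const_right _ _ hh.tendsto_dist
    refine tendsto_atTop_mono (fun n => ?_) this
    rw [conj_pow]
    linarith [(abs_le.1 (abs_dist_conj_sub_le o (u j) (h ^ n))).1]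
  · linarith [hp.2 _ (Set.smul_mem_smul_set hoB), hW j]
  · have key : ∀ j, ¬ ProjWithin A x (u j • o) (K + σ) →
        ProjWithin (u j • B) x o (max 0 W + K + 2 * σ + 1) := by
      intro j hj p hp
      obtain ⟨b, hb, rfl⟩ := hp.1
      have h1 := (hproj b hb).smul (u j)
      rw [huA] at h1
      have h2 := hA.escape (cyclicOrbit_nonempty o g) hj h1
      have h3 := hp.2 _ (Set.smul_mem_smul_set hoB)
      simp only at h3 ⊢
      linarith [hW j, dist_triangle o (u j • o) (u j • b)]
    by_contra! hn
    have hi := not_not.1 (mt (key i) hn.1)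
    have hj := not_not.1 (mt (key j) hn.2)
    obtain ⟨w, hw⟩ := exists_nearProj (cyclicOrbit_nonempty o g) x
    have h1 := hM i j (Fin.val_injective.ne hij)
    linarith [dist_triangle (u i • o) w (u j • o), hi w hw, hj w hw, dist_comm w (u j • o)]

end AxisFamily

/-! ### Simultaneously tame elements -/

section Combinatorics

/-- Each `P c` excludes at most one entry per column and each `Q c` one per row, so at most 2 |ι| N
of the N² pairs are bad. -/
theorem exists_pair_avoiding {ι : Type*} [Fintype ι] {N : ℕ} (hN : 2 * Fintype.card ι < N)
    (P Q : ι → Fin N → Fin N → Prop) (hP : ∀ c j, {i | P c i j}.Subsingleton)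
    (hQ : ∀ c i, {j | Q c i j}.Subsingleton) : ∃ i j, ∀ c, ¬ P c i j ∧ ¬ Q c i j := by
  by_contra! hbad
  choose c hc using hbad
  classical
  let F : Fin N × Fin N → (ι × Fin N) ⊕ (ι × Fin N) := fun p =>
    if P (c p.1 p.2) p.1 p.2 then Sum.inl (c p.1 p.2, p.2) else Sum.inr (c p.1 p.2, p.1)
  have hF : Function.Injective F := by
    rintro ⟨i, j⟩ ⟨i', j'⟩ h
    by_cases h1 : P (c i j) i j <;> by_cases h2 : P (c i' j') i' j' <;>
      simp only [F, h1, h2, if_true, if_false, Sum.inl.injEq, Sum.inr.injEq, Prod.mk.injEq,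
        reduceCtorEq] at h
    · obtain ⟨hcc, rfl⟩ := h
      rw [hP _ j h1 (by rw [Set.mem_ofPred_eq, hcc]; exact h2)]
    · obtain ⟨hcc, rfl⟩ := h
      rw [hQ _ i (hc i j h1) (by rw [Set.mem_ofPred_eq, hcc]; exact hc i j' h2)]
  have := Fintype.card_le_of_injective F hF
  simp only [Fintype.card_prod, Fintype.card_fin, Fintype.card_sum] at this
  nlinarith

theorem exists_index_avoiding {κ : Type*} [Fintype κ] {N : ℕ} (hN : Fintype.card κ < N)
    (P : κ → Fin N → Prop) (hP : ∀ c, {i | P c i}.Subsingleton) : ∃ i, ∀ c, ¬ P c i := by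
  by_contra! hbad
  choose c hc using hbad
  obtain ⟨i, j, hij, h⟩ := Fintype.exists_ne_map_eq_of_card_lt c (by simpa using hN)
  exact hij (hP _ (hc i) (by rw [Set.mem_ofPred_eq, h]; exact hc j))

end Combinatorics

section SingleSpace

open scoped Pointwise

variable {X : Type*} [MetricSpace X] {G : Type*} [Group G] [MulAction G X]

theorem IsAxisFamily.subsingleton {N : ℕ} {o : X} {K τ : ℝ} {A : Fin N → Set X} {a : Fin N → G}
    (h : IsAxisFamily o K τ A a) (x : X) : {i | ¬ ProjWithin (A i) x o τ}.Subsingleton := by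
  intro i hi j hj
  by_contra hij
  exact (h.dichotomy x i j hij).elim hi hj

theorem IsAxisFamily.subsingleton_frequently {N : ℕ} {o : X} {K τ : ℝ} {A : Fin N → Set X}
    {a : Fin N → G} (h : IsAxisFamily o K τ A a) (x : ℕ → X) :
    {i | ¬ ∃ᶠ m in atTop, ProjWithin (A i) (x m) o τ}.Subsingleton := by
  intro i hi j hj
  by_contra hij
  have : ∃ᶠ m in atTop, ProjWithin (A i) (x m) o τ ∨ ProjWithin (A j) (x m) o τ :=
    (Eventually.of_forall fun m => h.dichotomy (x m) i j hij).frequently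
  exact (frequently_or_distrib.1 this).elim hi hj

variable [IsIsometricSMul G X]

theorem dist_mul_smul_le (o : X) (x y : G) :
    dist o ((x * y) • o) ≤ dist o (x • o) + dist o (y • o) := by
  rw [mul_smul, ← dist_smul x o (y • o)]
  exact dist_triangle _ _ _

theorem dist_inv_smul_self (o : X) (x : G) : dist o (x⁻¹ • o) = dist o (x • o) := by
  rw [dist_comm, dist_inv_smul]

theorem dist_smul_le_mul_right (o : X) (x y : G) :
    dist o (x • o) ≤ dist o ((x * y) • o) + dist o (y • o) := by
  simpa [dist_inv_smul_self] using dist_mul_smul_le o (x * y) y⁻¹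

theorem dist_smul_le_mul_left (o : X) (x y : G) :
    dist o (y • o) ≤ dist o (x • o) + dist o ((x * y) • o) := by
  simpa [dist_inv_smul_self] using dist_mul_smul_le o x⁻¹ (x * y)

/-- An orbit of a tame element that frequently projects close to `o` in both directions projects
uniformly close to `o`. -/
theorem projWithin_zpow_of_frequently {o : X} {s c : G} {A : Set X} {K τ D : ℝ} (hK : 0 ≤ K)
    (hτ : 0 ≤ τ) (hA : Bottleneck K A) (hne : A.Nonempty) (hD : 0 ≤ D)
    (hs : ∀ i j k : ℤ, i ≤ j → j ≤ k → dist (s ^ i • o) (s ^ j • o) +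
      dist (s ^ j • o) (s ^ k • o) ≤ dist (s ^ i • o) (s ^ k • o) + D)
    (hp : ∃ᶠ m : ℕ in atTop, ProjWithin A (c • s ^ m • o) o τ)
    (hn : ∃ᶠ m : ℕ in atTop, ProjWithin A (c • s⁻¹ ^ m • o) o τ) (i : ℤ) :
    ProjWithin A (c • s ^ i • o) o (D + 2 * K + 2 * τ) := by
  intro z hz
  by_contra! hlt
  have key : ∀ y, ProjWithin A y o τ →
      dist (c • s ^ i • o) z + dist z o + dist o y ≤ dist (c • s ^ i • o) y + K + 2 * τ := by
    intro y hy
    obtain ⟨q, hq⟩ := exists_nearProj hne y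
    have h1 := hy q hq
    rcases hA _ _ _ _ hz hq with h | h
    · linarith [dist_triangle o q z, dist_comm q z]
    · linarith [dist_triangle z q o, dist_triangle o q y, dist_comm o q]
  -- With -n ≤ i ≤ m, the paths from `s ^ i o` to both ends would run through `z` and then `o`; this
  -- backtracking contradicts coarse geodesicity.
  obtain ⟨m, hm, hym⟩ := (frequently_atTop.1 hp) i.natAbs
  obtain ⟨n, hn, hyn⟩ := (frequently_atTop.1 hn) i.natAbs
  have h1 := key _ hym
  have h2 := key _ hyn
  have h3 := hs (-n) i m (by omega) (by omega)
  rw [inv_pow, ← zpow_natCast, ← zpow_neg] at h2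
  rw [← zpow_natCast] at h1
  rw [dist_smul] at h1 h2
  have h4 := dist_triangle (c • s ^ (-n : ℤ) • o) o (c • s ^ (m : ℤ) • o)
  rw [dist_smul] at h4
  linarith [dist_comm (s ^ (-n : ℤ) • o) (s ^ i • o), dist_comm o (c • s ^ (-n : ℤ) • o),
    dist_comm z o, dist_nonneg (x := c • s ^ i • o) (y := z)]

/-- If the orbit `⟨s⟩ o` projects to `A` close to `o` and `x` projects to `A` far from `o`, then
`x` projects to `⟨s⟩ o` close to `o`. -/
theorem projWithin_cyclicOrbit {o : X} {s c : G} {A : Set X} {K σ w : ℝ}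
    (hA : Bottleneck K A) (hne : A.Nonempty) (hs : ∀ i : ℤ, ProjWithin A (c • s ^ i • o) o σ)
    {x y : X} (hy : ¬ ProjWithin A y o (K + σ)) (hxy : dist y (c • x) ≤ w)
    (hc : dist o (c • o) ≤ w) :
    ProjWithin (cyclicOrbit o s) x o (K + 2 * σ + 1 + 4 * w) := by
  intro z hz
  obtain ⟨l, rfl⟩ := hz.1
  have h1 := hA.escape hne hy (hs l)
  have h2 := hz.2 o (self_mem_cyclicOrbit o s)
  simp only at h2 ⊢
  have h3 := dist_triangle y (c • x) (c • s ^ l • o)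
  have h4 := dist_triangle4 (c • x) y o (c • o)
  have h5 := dist_triangle (c • o) o (c • s ^ l • o)
  rw [dist_smul] at h3 h4 h5
  linarith [dist_comm (c • x) y, dist_comm o (c • o)]

end SingleSpace

section TwoSpaces

open scoped Pointwise

variable {X₁ X₂ : Type*} [MetricSpace X₁] [MetricSpace X₂] {G : Type*} [Group G]
  [MulAction G X₁] [MulAction G X₂] [IsIsometricSMul G X₁] [IsIsometricSMul G X₂]
  {o₁ : X₁} {o₂ : X₂}

theorem exists_large_displacement {a b : G}
    (ha : Tendsto (fun n : ℕ => dist o₁ (a ^ n • o₁)) atTop atTop)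
    (hb : Tendsto (fun n : ℕ => dist o₂ (b ^ n • o₂)) atTop atTop) (R : ℝ) :
    ∃ u : G, R < dist o₁ (u • o₁) ∧ R < dist o₂ (u • o₂) := by
  by_contra! h
  -- If no element is large in both spaces, both `a ^ p` and `a ^ p * b ^ q` are large in `X₁`,
  -- hence small in `X₂`, so `b ^ q` cannot be large there.
  obtain ⟨q, hq⟩ := (hb.eventually_gt_atTop (2 * R)).exists
  obtain ⟨p, hp, hp'⟩ := ((ha.eventually_gt_atTop R).and
    (ha.eventually_gt_atTop (R + dist o₁ (b ^ q • o₁)))).exists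
  have h1 := h _ hp
  have h2 := h (a ^ p * b ^ q) (by linarith [dist_smul_le_mul_right o₁ (a ^ p) (b ^ q)])
  linarith [dist_smul_le_mul_left o₂ (a ^ p) (b ^ q)]

theorem exists_separated {a b : G}
    (ha : Tendsto (fun n : ℕ => dist o₁ (a ^ n • o₁)) atTop atTop)
    (hb : Tendsto (fun n : ℕ => dist o₂ (b ^ n • o₂)) atTop atTop) (R : ℝ) (N : ℕ) :
    ∃ u : Fin N → G, ∀ i j, i ≠ j →
      R < dist (u i • o₁) (u j • o₁) ∧ R < dist (u i • o₂) (u j • o₂) := by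
  obtain ⟨v, -, hv⟩ := exists_seq_of_forall_finset_exists (fun _ : G => True)
    (fun x y => R < dist (x • o₁) (y • o₁) ∧ R < dist (x • o₂) (y • o₂)) (fun s _ => by
      obtain ⟨W₁, hW₁⟩ := (s.image fun x => dist o₁ (x • o₁)).exists_le
      obtain ⟨W₂, hW₂⟩ := (s.image fun x => dist o₂ (x • o₂)).exists_le
      obtain ⟨u, h1, h2⟩ := exists_large_displacement ha hb (R + max W₁ W₂)
      refine ⟨u, trivial, fun x hx => ⟨?_, ?_⟩⟩
      · linarith [hW₁ _ (Finset.mem_image_of_mem _ hx), dist_triangle o₁ (x • o₁) (u • o₁),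
          le_max_left W₁ W₂]
      · linarith [hW₂ _ (Finset.mem_image_of_mem _ hx), dist_triangle o₂ (x • o₂) (u • o₂),
          le_max_right W₁ W₂])
  refine ⟨fun i => v i, fun i j hij => ?_⟩
  rcases lt_or_gt_of_ne hij with h | h
  · exact hv i j h
  · rw [dist_comm, dist_comm (v i • o₂)]
    exact hv j i h

variable {K₁ τ₁ K₂ τ₂ : ℝ} {A : Fin 9 → Set X₁} {B : Fin 9 → Set X₂} {a b : Fin 9 → G}

/-- The words a_i^n · (b_j^k g u) and b_j^k · (g u a_i^n) are cyclic permutations of each other. The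
displacement transverse to `A i` does not involve `i`, and the one transverse to `B j` does not
involve `j`, so bad indices are rare in rows and columns. `P` and `Q` leave room for further
requirements. -/
theorem IsAxisFamily.exists_isTransverse (hA : IsAxisFamily o₁ K₁ τ₁ A a)
    (hB : IsAxisFamily o₂ K₂ τ₂ B b) {n k : ℕ}
    (hn : ∀ i, 10 * K₁ + 10 * τ₁ + 1 ≤ dist o₁ (a i ^ n • o₁))
    (hk : ∀ j, 10 * K₂ + 10 * τ₂ + 1 ≤ dist o₂ (b j ^ k • o₂)) :
    ∃ C, ∀ (g : G) (P Q : Fin 2 → Fin 9 → Fin 9 → Prop), (∀ c j, {i | P c i j}.Subsingleton) →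
      (∀ c i, {j | Q c i j}.Subsingleton) → ∃ u i j, dist o₁ (u • o₁) ≤ C ∧
        dist o₂ (u • o₂) ≤ C ∧ (∀ c, ¬ P c i j ∧ ¬ Q c i j) ∧
        IsTransverse o₁ (A i) K₁ τ₁ (a i ^ n) (b j ^ k * g * u) ∧
        IsTransverse o₂ (B j) K₂ τ₂ (b j ^ k) (g * u * a i ^ n) := by
  obtain ⟨W, hW⟩ := Finite.exists_le fun i => dist o₂ (a i ^ n • o₂)
  -- Two candidates violating the same `far` bound would be this close; in `X₂` the factor `a i ^ n`
  -- after `u` costs `2 * W`. There are 9 + 9 bounds, so 19 candidates suffice.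
  obtain ⟨v, hv⟩ := exists_separated (o₁ := o₁) (o₂ := o₂) (hA.unbounded 0) (hB.unbounded 0)
    (max (2 * (K₁ + 2 * τ₁)) (2 * (K₂ + 2 * τ₂) + 2 * W)) 19
  obtain ⟨C₁, hC₁⟩ := Finite.exists_le fun i => dist o₁ (v i • o₁)
  obtain ⟨C₂, hC₂⟩ := Finite.exists_le fun i => dist o₂ (v i • o₂)
  refine ⟨max C₁ C₂, fun g P Q hP hQ => ?_⟩
  obtain ⟨r, hr⟩ := exists_index_avoiding (κ := Fin 9 ⊕ Fin 9) (N := 19) (by simp)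
    (Sum.elim (fun j r => dist o₁ ((b j ^ k * g * v r) • o₁) ≤ K₁ + 2 * τ₁)
      (fun i r => dist o₂ ((g * v r * a i ^ n) • o₂) ≤ K₂ + 2 * τ₂)) (by
    rintro (j | i) r hr r' hr' <;> simp only [Sum.elim_inl, Sum.elim_inr, Set.mem_ofPred_eq] at hr hr'
    · by_contra hne
      have h1 := (hv r r' hne).1
      have h2 := le_max_left (2 * (K₁ + 2 * τ₁)) (2 * (K₂ + 2 * τ₂) + 2 * W)
      have h3 := dist_triangle ((b j ^ k * g * v r) • o₁) o₁ ((b j ^ k * g * v r') • o₁)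
      rw [mul_smul _ (v r), mul_smul _ (v r'), dist_smul] at h3
      rw [mul_smul, dist_comm] at hr
      rw [mul_smul] at hr'
      linarith [dist_comm o₁ ((b j ^ k * g) • v r • o₁)]
    · by_contra hne
      have h1 := (hv r r' hne).2
      have h2 := le_max_right (2 * (K₁ + 2 * τ₁)) (2 * (K₂ + 2 * τ₂) + 2 * W)
      have h3 := dist_triangle ((g * v r * a i ^ n) • o₂) o₂ ((g * v r' * a i ^ n) • o₂)
      rw [mul_assoc, mul_assoc, mul_smul g, mul_smul g, dist_smul, mul_smul (v r),
        mul_smul (v r')] at h3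
      have h4 := dist_triangle4 (v r • o₂) (v r • a i ^ n • o₂) (v r' • a i ^ n • o₂) (v r' • o₂)
      rw [dist_smul, dist_smul (v r')] at h4
      rw [mul_assoc, mul_smul, mul_smul] at hr hr'
      linarith [dist_comm o₂ (g • v r • a i ^ n • o₂), hW i, dist_comm o₂ (a i ^ n • o₂)])
  -- Four conditions on each index, two from the caller and two for the displacement and its
  -- inverse; hence 9 = 2 · 4 + 1 axes.
  obtain ⟨i, j, hij⟩ := exists_pair_avoiding (ι := Fin 2 ⊕ Fin 2) (N := 9) (by simp)
    (Sum.elim P ![fun i j => ¬ ProjWithin (A i) ((b j ^ k * g * v r) • o₁) o₁ τ₁,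
      fun i j => ¬ ProjWithin (A i) ((b j ^ k * g * v r)⁻¹ • o₁) o₁ τ₁])
    (Sum.elim Q ![fun i j => ¬ ProjWithin (B j) ((g * v r * a i ^ n) • o₂) o₂ τ₂,
      fun i j => ¬ ProjWithin (B j) ((g * v r * a i ^ n)⁻¹ • o₂) o₂ τ₂])
    (by
      rintro (c | c) j
      · exact hP c j
      · fin_cases c <;> exact hA.subsingleton _)
    (by
      rintro (c | c) i
      · exact hQ c i
      · fin_cases c <;> exact hB.subsingleton _)
  have f0 := hij (Sum.inr 0)
  have f1 := hij (Sum.inr 1)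
  simp only [Sum.elim_inr, Matrix.cons_val_zero, Matrix.cons_val_one, not_not] at f0 f1
  exact ⟨v r, i, j, (hC₁ r).trans (le_max_left _ _), (hC₂ r).trans (le_max_right _ _),
    fun c => hij (Sum.inl c),
    ⟨hA.K_nonneg, hA.τ_nonneg, hA.bott i, hA.nonempty i, hA.pow_smul_eq i n, hA.base i, f0.1, f1.1,
      not_le.1 (hr (Sum.inl j)), hn i⟩,
    ⟨hB.K_nonneg, hB.τ_nonneg, hB.bott j, hB.nonempty j, hB.pow_smul_eq j k, hB.base j, f0.2, f1.2,
      not_le.1 (hr (Sum.inr i)), hk j⟩⟩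

/-- Up to a bounded error in displacement, every element is simultaneously tame, with
translation length close to its displacement in both spaces. -/
theorem IsAxisFamily.exists_isTame (hA : IsAxisFamily o₁ K₁ τ₁ A a)
    (hB : IsAxisFamily o₂ K₂ τ₂ B b) : ∃ C, ∀ g : G, ∃ (t : G) (l₁ l₂ : ℝ), 0 < l₁ ∧ 0 < l₂ ∧
      IsTame o₁ t l₁ ∧ IsTame o₂ t l₂ ∧ dist o₁ (g • o₁) - C ≤ l₁ ∧ dist o₂ (g • o₂) - C ≤ l₂ ∧
      dist o₁ (t • o₁) ≤ dist o₁ (g • o₁) + C ∧ dist o₂ (t • o₂) ≤ dist o₂ (g • o₂) + C := by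
  obtain ⟨n, hn⟩ := hA.exists_pow (10 * K₁ + 10 * τ₁ + 1)
  obtain ⟨k, hk⟩ := hB.exists_pow (10 * K₂ + 10 * τ₂ + 1)
  obtain ⟨C, hC⟩ := hA.exists_isTransverse hB hn hk
  obtain ⟨W₁, hW₁⟩ := Finite.exists_le fun i => dist o₁ (a i ^ n • o₁)
  obtain ⟨W₂, hW₂⟩ := Finite.exists_le fun i => dist o₂ (a i ^ n • o₂)
  obtain ⟨V₁, hV₁⟩ := Finite.exists_le fun i => dist o₁ (b i ^ k • o₁)
  obtain ⟨V₂, hV₂⟩ := Finite.exists_le fun i => dist o₂ (b i ^ k • o₂)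
  have w1 := dist_nonneg.trans (hW₁ 0)
  have w2 := dist_nonneg.trans (hW₂ 0)
  have v1 := dist_nonneg.trans (hV₁ 0)
  have v2 := dist_nonneg.trans (hV₂ 0)
  refine ⟨C + W₁ + W₂ + V₁ + V₂, fun g => ?_⟩
  obtain ⟨u, i, j, hu₁, hu₂, -, h₁, h₂⟩ := hC g (fun _ _ _ => False) (fun _ _ _ => False)
    (fun c j => Set.subsingleton_empty) (fun c j => Set.subsingleton_empty)
  have e : a i ^ n * (b j ^ k * g * u) =
      a i ^ n * (b j ^ k * (g * u * a i ^ n)) * (a i ^ n)⁻¹ := by group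
  refine ⟨a i ^ n * (b j ^ k * g * u), dist o₁ ((b j ^ k * g * u) • o₁) + 1,
    dist o₂ ((g * u * a i ^ n) • o₂) + 1, by positivity, by positivity, h₁.isTame, ?_, ?_, ?_,
    ?_, ?_⟩
  · rw [e]
    exact h₂.isTame.conj _
  · linarith [dist_smul_le_mul_left o₁ (b j ^ k) g, dist_smul_le_mul_right o₁ (b j ^ k * g) u,
      hV₁ j]
  · linarith [dist_smul_le_mul_right o₂ g u, dist_smul_le_mul_right o₂ (g * u) (a i ^ n), hW₂ i]
  · linarith [dist_mul_smul_le o₁ (a i ^ n) (b j ^ k * g * u), dist_mul_smul_le o₁ (b j ^ k * g) u,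
      dist_mul_smul_le o₁ (b j ^ k) g, hW₁ i, hV₁ j]
  · linarith [dist_mul_smul_le o₂ (a i ^ n) (b j ^ k * g * u), dist_mul_smul_le o₂ (b j ^ k * g) u,
      dist_mul_smul_le o₂ (b j ^ k) g, hW₂ i, hV₂ j]

/-- For every simultaneously tame `s` there is a simultaneously tame `f` whose positive orbit
projects to the axis of `s` in a bounded set, in both spaces. -/
theorem IsAxisFamily.exists_isTame_transverse (hA : IsAxisFamily o₁ K₁ τ₁ A a)
    (hB : IsAxisFamily o₂ K₂ τ₂ B b) {s : G} {l₁ l₂ : ℝ} (hs₁ : IsTame o₁ s l₁)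
    (hs₂ : IsTame o₂ s l₂) : ∃ (f : G) (m₁ m₂ R₁ R₂ : ℝ), 0 < m₁ ∧ 0 < m₂ ∧ IsTame o₁ f m₁ ∧
      IsTame o₂ f m₂ ∧
      (∀ i : ℕ, ProjWithin (cyclicOrbit o₁ s) (f ^ (i + 1) • o₁) o₁ R₁) ∧
      (∀ i : ℕ, ProjWithin (cyclicOrbit o₂ s) (f ^ (i + 1) • o₂) o₂ R₂) := by
  obtain ⟨D₁, hD₁, hm₁⟩ := hs₁.exists_morse
  obtain ⟨D₂, hD₂, hm₂⟩ := hs₂.exists_morse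
  have hK₁ := hA.K_nonneg
  have hτ₁ := hA.τ_nonneg
  have hK₂ := hB.K_nonneg
  have hτ₂ := hB.τ_nonneg
  -- The extra `D₁` makes the translation outrun the bound for the projection of the whole orbit of
  -- `s`.
  obtain ⟨n, hn⟩ := hA.exists_pow (10 * K₁ + 10 * τ₁ + 1 + D₁)
  obtain ⟨k, hk⟩ := hB.exists_pow (10 * K₂ + 10 * τ₂ + 1 + D₂)
  obtain ⟨C, hC⟩ := hA.exists_isTransverse hB (fun i => by linarith [hn i])
    (fun j => by linarith [hk j])
  -- In `X₂` the word transverse to `B j` is `f` conjugated by `(a i ^ n)⁻¹`, so the orbit of `s` is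
  -- moved by the same element there.
  obtain ⟨u, i, j, -, -, hPQ, h₁, h₂⟩ := hC 1
    ![fun i _ => ¬ ∃ᶠ m : ℕ in atTop, ProjWithin (A i) ((1 : G) • s ^ m • o₁) o₁ τ₁,
      fun i _ => ¬ ∃ᶠ m : ℕ in atTop, ProjWithin (A i) ((1 : G) • s⁻¹ ^ m • o₁) o₁ τ₁]
    ![fun i j => ¬ ∃ᶠ m : ℕ in atTop, ProjWithin (B j) ((a i ^ n)⁻¹ • s ^ m • o₂) o₂ τ₂,
      fun i j => ¬ ∃ᶠ m : ℕ in atTop, ProjWithin (B j) ((a i ^ n)⁻¹ • s⁻¹ ^ m • o₂) o₂ τ₂]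
    (by intro c j; fin_cases c <;> exact hA.subsingleton_frequently _)
    (by intro c i; fin_cases c <;> exact hB.subsingleton_frequently _)
  have f0 := hPQ 0
  have f1 := hPQ 1
  simp only [Matrix.cons_val_zero, Matrix.cons_val_one, not_not] at f0 f1
  set t := b j ^ k * (1 * u * a i ^ n) with ht
  have e : a i ^ n * (b j ^ k * 1 * u) = a i ^ n * t * (a i ^ n)⁻¹ := by rw [ht]; group
  have T₂ := h₂.isTame.conj (a i ^ n)
  rw [← ht, ← e] at T₂
  refine ⟨a i ^ n * (b j ^ k * 1 * u), _, _, K₁ + 2 * (D₁ + 2 * K₁ + 2 * τ₁) + 1 + 4 * 0,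
    K₂ + 2 * (D₂ + 2 * K₂ + 2 * τ₂) + 1 + 4 * dist o₂ (a i ^ n • o₂), ?_, ?_, h₁.isTame, T₂,
    fun r => ?_, fun r => ?_⟩
  · positivity
  · positivity
  · have hs := projWithin_zpow_of_frequently hK₁ hτ₁ (hA.bott i) (hA.nonempty i) hD₁ hm₁ f0.1 f1.1
    refine projWithin_cyclicOrbit (w := 0) (hA.bott i) (hA.nonempty i) hs
      (not_projWithin (hA.nonempty i) (h₁.projWithin_pow r) ?_) (by simp) (by simp)
    rw [dist_comm]
    linarith [hn i]
  · have hs := projWithin_zpow_of_frequently hK₂ hτ₂ (hB.bott j) (hB.nonempty j) hD₂ hm₂ f0.2 f1.2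
    refine projWithin_cyclicOrbit (hB.bott j) (hB.nonempty j) hs
      (not_projWithin (hB.nonempty j) (h₂.projWithin_pow r) ?_) ?_ (dist_inv_smul_self _ _).le
    · rw [dist_comm]
      linarith [hk j]
    · have e' : (a i ^ n)⁻¹ * (a i ^ n * t ^ (r + 1) * (a i ^ n)⁻¹) = t ^ (r + 1) * (a i ^ n)⁻¹ := by
        group
      change dist (t ^ (r + 1) • o₂) _ ≤ _
      rw [e, conj_pow, smul_smul, e', mul_smul, dist_smul, dist_inv_smul_self]

end TwoSpaces

/-! ### Sequences accumulating at the attracting point of a tame element -/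

section Accumulation

variable {X : Type*} [MetricSpace X]

/-- Arzelà–Ascoli: Tychonoff gives pointwise compactness, and the common Lipschitz bound gives
equicontinuity. This supplies accumulation points in the compact-open topology. -/
theorem isCompact_normalized_lipschitz (o : X) :
    IsCompact {f : C(X, ℝ) | f o = 0 ∧ ∀ x y, |f x - f y| ≤ dist x y} := by
  refine ArzelaAscoli.isCompact_of_equicontinuous _ ?_ ?_
  · have himg : ContinuousMap.toFun '' {f : C(X, ℝ) | f o = 0 ∧ ∀ x y, |f x - f y| ≤ dist x y} =
        {f : X → ℝ | f o = 0 ∧ ∀ x y, |f x - f y| ≤ dist x y} := by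
      ext f
      constructor
      · rintro ⟨f, hf, rfl⟩
        exact hf
      · intro hf
        have hL : LipschitzWith 1 f := LipschitzWith.of_dist_le_mul fun x y => by
          rw [Real.dist_eq, NNReal.coe_one, one_mul]
          exact hf.2 x y
        exact ⟨⟨f, hL.continuous⟩, hf, rfl⟩
    rw [himg]
    refine (isCompact_univ_pi fun x : X =>
      isCompact_Icc (a := -dist x o) (b := dist x o)).of_isClosed_subset ?_ ?_
    · refine (isClosed_eq (by fun_prop) (by fun_prop)).inter ?_
      have e : {f : X → ℝ | ∀ x y, |f x - f y| ≤ dist x y} =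
          ⋂ x, ⋂ y, {f | |f x - f y| ≤ dist x y} := by ext; simp
      change IsClosed {f : X → ℝ | ∀ x y, |f x - f y| ≤ dist x y}
      rw [e]
      refine isClosed_iInter fun x => isClosed_iInter fun y => ?_
      exact isClosed_le (by fun_prop) (by fun_prop)
    · intro f hf x _
      have := hf.2 x o
      rw [hf.1, sub_zero] at this
      exact abs_le.1 this
  · refine (LipschitzWith.uniformEquicontinuous _ 1 fun f => ?_).equicontinuous
    refine LipschitzWith.of_dist_le_mul fun x y => ?_
    rw [Real.dist_eq, NNReal.coe_one, one_mul]
    exact f.2.2 x y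

theorem busemann_mem_normalized_lipschitz (o y : X) :
    busemann o y ∈ {f : C(X, ℝ) | f o = 0 ∧ ∀ x y, |f x - f y| ≤ dist x y} := by
  refine ⟨sub_self _, fun x z => ?_⟩
  change |dist x y - dist o y - (dist z y - dist o y)| ≤ dist x z
  rw [sub_sub_sub_cancel_right]
  exact abs_dist_sub_le x z y

theorem frequently_busemann_lt {ι : Type*} {l : Filter ι} {o : X} {y : ι → X} {F : C(X, ℝ)}
    (h : MapClusterPt F l fun n => busemann o (y n)) (x : X) :
    ∃ᶠ n in l, dist x (y n) - dist o (y n) < F x + 1 :=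
  h.frequently (p := fun f => f x < F x + 1)
    (((continuous_eval_const x).tendsto F).eventually (Iio_mem_nhds (lt_add_one _)))

theorem frequently_lt_busemann {ι : Type*} {l : Filter ι} {o : X} {y : ι → X} {F : C(X, ℝ)}
    (h : MapClusterPt F l fun n => busemann o (y n)) (x : X) :
    ∃ᶠ n in l, F x - 1 < dist x (y n) - dist o (y n) :=
  h.frequently (p := fun f => F x - 1 < f x)
    (((continuous_eval_const x).tendsto F).eventually (Ioi_mem_nhds (sub_one_lt _)))

variable {G : Type*} [Group G] [MulAction G X] [IsIsometricSMul G X]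

theorem IsTame.accumulationPoint_le {o : X} {f c : G} {D : ℝ}
    (hD : ∀ i j k : ℤ, i ≤ j → j ≤ k → dist (f ^ i • o) (f ^ j • o) +
      dist (f ^ j • o) (f ^ k • o) ≤ dist (f ^ i • o) (f ^ k • o) + D) {F : C(X, ℝ)}
    (hF : IsAccumulationPoint o (fun n => (c * f * c⁻¹) ^ n • o) F) (i : ℕ) :
    F (c • f ^ i • o) ≤ -dist o (f ^ i • o) + D + 3 * dist o (c • o) + 1 := by
  obtain ⟨n, hn, hin⟩ :=
    ((frequently_lt_busemann hF (c • f ^ i • o)).and_eventually (eventually_ge_atTop i)).exists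
  have h1 := hD 0 i n (by positivity) (by exact_mod_cast hin)
  rw [zpow_zero, one_smul, zpow_natCast, zpow_natCast] at h1
  have h2 := (abs_le.1 (abs_dist_conj_sub_le o c (f ^ n))).1
  rw [conj_pow] at hn
  have h3 : dist (c • f ^ i • o) ((c * f ^ n * c⁻¹) • o) ≤
      dist (f ^ i • o) (f ^ n • o) + dist o (c • o) := by
    rw [mul_assoc, mul_smul, dist_smul, mul_smul]
    refine (dist_triangle _ (f ^ n • o) _).trans ?_
    rw [dist_smul, dist_inv_smul_self]
  linarith

/-- Convergence to the attracting point pushes projections to the axis towards +∞: horofunctions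
there tend to -∞ along the positive orbit, whereas points projecting before `M` give functions that
grow along it. -/
theorem IsTame.eventually_le_of_accumulatesIn {o : X} {f c : G} {l : ℝ} (hf : IsTame o f l)
    (hl : 0 < l) {y : ℕ → X} (hy : AccumulatesIn o y (attractingPoint o (c * f * c⁻¹))) (M : ℤ) :
    ∀ᶠ n in atTop, ∀ i : ℤ, NearProj (cyclicOrbit o f) (c⁻¹ • y n) (f ^ i • o) → M ≤ i := by
  by_contra hbad
  rw [not_eventually] at hbad
  simp only [not_forall, not_le, exists_prop] at hbad
  obtain ⟨K, hK, hb⟩ := hf.bott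
  obtain ⟨D, hD0, hD⟩ := hf.exists_morse
  have := frequently_iff_neBot.1 hbad
  -- The cluster point is taken along the bad indices only, so bad indices occur frequently near
  -- `F`.
  obtain ⟨F, -, hF⟩ := (isCompact_normalized_lipschitz o).exists_mapClusterPt
    (f := atTop ⊓ 𝓟 {n | ∃ i : ℤ, NearProj (cyclicOrbit o f) (c⁻¹ • y n) (f ^ i • o) ∧ i < M})
    (u := fun n => busemann o (y n)) (le_principal_iff.2 (mem_map.2 (univ_mem' fun n => busemann_mem_normalized_lipschitz o (y n))))
  obtain ⟨hFb, ξ, hξ, hcl⟩ := hy F (hF.mono inf_le_left)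
  obtain ⟨κ, hκ⟩ := Quotient.exact hcl
  have hκ0 : 0 ≤ κ := (abs_nonneg _).trans (hκ o)
  set w := dist o (c • o) with hw
  have hw0 : 0 ≤ w := dist_nonneg
  have hv0 : 0 ≤ M.natAbs * dist o (f • o) := by positivity
  obtain ⟨i, hi⟩ := ((hf.tendsto hl).eventually_gt_atTop
    (2 * D + 4 * w + κ + K + 3 + M.natAbs * dist o (f • o))).exists
  have hξi := IsTame.accumulationPoint_le hD hξ i
  have hFi := (abs_le.1 (hκ (c • f ^ i • o))).1
  obtain ⟨n, hn, j, hj, hjM⟩ := ((frequently_busemann_lt hF (c • f ^ i • o)).and_eventually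
    (eventually_inf_principal.2 (Eventually.of_forall fun n hn => hn))).exists
  have h1 := hb.between hK hj (pow_smul_mem o f i)
  have h2 := dist_triangle o (c • o) (y n)
  have h3 : dist (c • o) (y n) = dist o (c⁻¹ • y n) := by
    rw [dist_comm, ← dist_inv_smul, dist_comm]
  have h4 : dist (c • f ^ i • o) (y n) = dist (c⁻¹ • y n) (f ^ i • o) := by
    rw [dist_inv_smul, dist_comm]
  have h5 := dist_triangle o (f ^ j • o) (c⁻¹ • y n)
  have h6 := dist_comm (f ^ j • o) (c⁻¹ • y n)
  simp only at hFi
  -- For `0 ≤ j < M` the point `f ^ j o` stays in a bounded set. For `j < 0`, `o` lies between `f ^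
  -- j o` and `f ^ i o`, so the unbounded term `dist o (f ^ j • o)` cancels.
  rcases le_or_gt 0 j with hj0 | hj0
  · have h7 := dist_pow_smul_le o f j.natAbs
    rw [← dist_zpow_smul_natAbs] at h7
    have h8 : (j.natAbs : ℝ) ≤ M.natAbs := by exact_mod_cast (by omega : j.natAbs ≤ M.natAbs)
    have h9 := mul_le_mul_of_nonneg_right h8 (dist_nonneg (x := o) (y := f • o))
    linarith [dist_triangle o (f ^ j • o) (f ^ i • o)]
  · have h7 := hD j 0 i hj0.le (by positivity)
    rw [zpow_zero, one_smul, zpow_natCast] at h7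
    linarith [dist_comm o (f ^ j • o)]

/-- The Gromov product at `o` of sequences accumulating at `[s⁺]` and at `s ^ m [f⁺]` equals
`d(o, s ^ m o)` up to an error independent of `m`. -/
theorem IsTame.exists_gromovProduct_bound {o : X} {s f : G} {l l' R : ℝ} (hs : IsTame o s l)
    (hl : 0 < l) (hf : IsTame o f l') (hl' : 0 < l')
    (hR : ∀ i : ℕ, ProjWithin (cyclicOrbit o s) (f ^ (i + 1) • o) o R) :
    ∃ E, ∀ (m : ℕ) (x y : ℕ → X), AccumulatesIn o x (attractingPoint o s) →
      AccumulatesIn o y (attractingPoint o (s ^ m * f * (s ^ m)⁻¹)) →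
      ∀ᶠ n in atTop,
        |dist o (x n) + dist o (y n) - dist (x n) (y n) - 2 * dist o (s ^ m • o)| ≤ E := by
  obtain ⟨K, hK, hb⟩ := hs.bott
  obtain ⟨D, hD0, hD⟩ := hs.exists_morse
  obtain ⟨K', hK', hb'⟩ := hf.bott
  have hne := cyclicOrbit_nonempty o s
  have hR0 : 0 ≤ R := by
    obtain ⟨p, hp⟩ := exists_nearProj hne (f ^ (0 + 1) • o)
    exact dist_nonneg.trans (hR 0 p hp)
  obtain ⟨N, hN⟩ := eventually_atTop.1 ((hs.tendsto hl).eventually_gt_atTop (2 * K + R))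
  obtain ⟨N', hN'⟩ := eventually_atTop.1 ((hf.tendsto hl').eventually_gt_atTop
    (K + K' + 2 * R + 1))
  refine ⟨5 * K + 4 * R + D + 2, fun m x y hx hy => ?_⟩
  -- Only the index thresholds depend on `m`: `N`, `N'` and the error come from `s` and `f` alone.
  -- The `+ 1` makes the index on the axis of `f` positive, as `hR` requires.
  have ex := hs.eventually_le_of_accumulatesIn (c := 1) hl (by simpa using hx) (m + N)
  have ey := hf.eventually_le_of_accumulatesIn hl' hy (N' + 1)
  filter_upwards [ex, ey] with n hxn hyn
  rw [inv_one, one_smul] at hxn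
  have hyo : ProjWithin (cyclicOrbit o s) (y n) (s ^ m • o) (K + R) := by
    have : ProjWithin (cyclicOrbit o s) ((s ^ m)⁻¹ • y n) o (K + R) := by
      by_contra hcon
      obtain ⟨p, hp⟩ := exists_nearProj (cyclicOrbit_nonempty o f) ((s ^ m)⁻¹ • y n)
      obtain ⟨j, rfl⟩ := hp.1
      have hj := hyn j hp
      obtain ⟨i, rfl⟩ : ∃ i : ℕ, j = (i + 1 : ℕ) := ⟨(j - 1).toNat, by omega⟩
      -- Here `f ^ (i + 1) o` would lie between the point and `o`, and `o` between the point and `f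
      -- ^ (i + 1) o`, bounding their distance.
      have h1 := hb'.between hK' hp (self_mem_cyclicOrbit o f)
      simp only [zpow_natCast] at h1
      have h2 := hb.escape hne hcon (hR i)
      have h3 := hN' (i + 1) (by omega)
      linarith [dist_comm o (f ^ (i + 1) • o), dist_nonneg (x := o) (y := f ^ (i + 1) • o)]
    have := this.smul (s ^ m)
    rw [smul_inv_smul] at this
    have e := zpow_smul_cyclicOrbit o s m
    rw [zpow_natCast] at e
    rwa [e] at this
  obtain ⟨p, hp⟩ := exists_nearProj hne (x n)
  obtain ⟨i, rfl⟩ := hp.1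
  have him := hxn i hp
  have hfar : ¬ ProjWithin (cyclicOrbit o s) (x n) (s ^ m • o) (K + (K + R)) := by
    intro hcon
    have h1 := hcon _ hp
    simp only [← zpow_natCast, dist_zpow_smul] at h1
    rw [dist_zpow_smul_natAbs] at h1
    linarith [hN (i - m).natAbs (by omega)]
  have h1 := hb.escape hne hfar hyo
  have h2 := hb.between hK hp (self_mem_cyclicOrbit o s)
  have h3 := hD 0 m i (by positivity) (by omega)
  rw [zpow_zero, one_smul, zpow_natCast] at h3
  simp only at h2
  obtain ⟨q, hq⟩ := exists_nearProj hne (y n)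
  have h4 := hyo q hq
  have h5 := hb.between hK hq (self_mem_cyclicOrbit o s)
  have c1 := dist_comm o (x n)
  have c2 := dist_comm o (y n)
  have c3 := dist_comm (x n) (s ^ m • o)
  have c4 := dist_comm (y n) (s ^ m • o)
  rw [abs_le]
  constructor
  · linarith [dist_triangle (x n) (s ^ m • o) (y n), dist_triangle (y n) q (s ^ m • o),
      dist_triangle (s ^ m • o) q o, dist_comm q (s ^ m • o), dist_comm o (s ^ m • o),
      dist_triangle (s ^ m • o) (s ^ i • o) (x n), dist_comm (s ^ i • o) (x n),
      dist_comm (s ^ i • o) o]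
  · linarith [dist_triangle o (s ^ m • o) (x n), dist_triangle o (s ^ m • o) (y n)]

end Accumulation

/-! ### Rigidity -/

section Rigidity

variable {X₁ X₂ : Type*} [MetricSpace X₁] [MetricSpace X₂] {G : Type*} [Group G]
  [MulAction G X₁] [MulAction G X₂] [IsIsometricSMul G X₁] [IsIsometricSMul G X₂]
  {o₁ : X₁} {o₂ : X₂}

theorem stableLength_eq_of_abs_sub_le {s : G} {C : ℝ}
    (h : ∀ m : ℕ, |dist o₁ (s ^ m • o₁) - dist o₂ (s ^ m • o₂)| ≤ C) :
    stableLength o₁ s = stableLength o₂ s := by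
  have h1 := (tendsto_stableLength o₁ s).sub (tendsto_stableLength o₂ s)
  have h2 : Tendsto (fun n : ℕ => dist o₁ (s ^ n • o₁) / (n : ℝ) - dist o₂ (s ^ n • o₂) / (n : ℝ))
      atTop (𝓝 0) := by
    refine squeeze_zero_norm (fun n => ?_) (tendsto_const_div_atTop_nhds_zero_nat C)
    rw [← sub_div, norm_div, Real.norm_eq_abs, Real.norm_eq_abs, Nat.abs_cast]
    exact div_le_div_of_nonneg_right (h n) (Nat.cast_nonneg n)
  exact sub_eq_zero.1 (tendsto_nhds_unique h1 h2)

/-- For the tame `t` attached to `g`, |g|₁ - C ≤ ℓ₁(t) = ℓ₂(t) ≤ |t|₂ ≤ |g|₂ + C, and symmetrically.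
-/
theorem exists_abs_dist_sub_le [ProperSpace X₁] [ProperSpace X₂] (hX₁ : IsGeodesicSpace X₁)
    (hX₂ : IsGeodesicSpace X₂) (h₁ : HasContractingProperty G o₁)
    (h₂ : HasContractingProperty G o₂)
    (hl : ∀ (t : G) (l₁ l₂ : ℝ), 0 < l₁ → 0 < l₂ → IsTame o₁ t l₁ → IsTame o₂ t l₂ →
      stableLength o₁ t = stableLength o₂ t) :
    ∃ C, ∀ g : G, |dist o₁ (g • o₁) - dist o₂ (g • o₂)| ≤ C := by
  obtain ⟨K₁, τ₁, A, a, hA⟩ := h₁.exists_isAxisFamily hX₁ 9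
  obtain ⟨K₂, τ₂, B, b, hB⟩ := h₂.exists_isAxisFamily hX₂ 9
  obtain ⟨C, hC⟩ := hA.exists_isTame hB
  refine ⟨2 * C, fun g => ?_⟩
  obtain ⟨t, l₁, l₂, hl₁, hl₂, ht₁, ht₂, e1, e2, e3, e4⟩ := hC g
  have h := hl t l₁ l₂ hl₁ hl₂ ht₁ ht₂
  have f1 := ht₁.le_stableLength
  have f2 := ht₂.le_stableLength
  have f3 := stableLength_le o₁ t
  have f4 := stableLength_le o₂ t
  rw [abs_le]
  constructor <;> linarith

/-- The extension condition propagates equality of stable lengths from `H` to all simultaneously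
tame elements. -/
theorem ExtensionCondition.stableLength_eq [ProperSpace X₁] [ProperSpace X₂]
    (hX₁ : IsGeodesicSpace X₁) (hX₂ : IsGeodesicSpace X₂) (h₁ : HasContractingProperty G o₁)
    (h₂ : HasContractingProperty G o₂) {H : Subgroup G} (hext : ExtensionCondition o₁ o₂ H) {C : ℝ}
    (hC : ∀ h ∈ H, |dist o₁ (h • o₁) - dist o₂ (h • o₂)| ≤ C) {s : G} {l₁ l₂ : ℝ} (hl₁ : 0 < l₁)
    (hl₂ : 0 < l₂) (hs₁ : IsTame o₁ s l₁) (hs₂ : IsTame o₂ s l₂) :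
    stableLength o₁ s = stableLength o₂ s := by
  obtain ⟨K₁, τ₁, A, a, hA⟩ := h₁.exists_isAxisFamily hX₁ 9
  obtain ⟨K₂, τ₂, B, b, hB⟩ := h₂.exists_isAxisFamily hX₂ 9
  obtain ⟨f, m₁, m₂, R₁, R₂, hm₁, hm₂, hf₁, hf₂, hR₁, hR₂⟩ :=
    hA.exists_isTame_transverse hB hs₁ hs₂
  obtain ⟨E₁, hE₁⟩ := hs₁.exists_gromovProduct_bound hl₁ hf₁ hm₁ hR₁
  obtain ⟨E₂, hE₂⟩ := hs₂.exists_gromovProduct_bound hl₂ hf₂ hm₂ hR₂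
  obtain ⟨x, hx₁, hx₂⟩ :=
    hext s ⟨hs₁.isContractingElement hl₁, hs₂.isContractingElement hl₂⟩
  -- Each Gromov product contributes its own error, and each of its three distances changes by at
  -- most `C` between the spaces.
  refine stableLength_eq_of_abs_sub_le (C := E₁ + E₂ + 3 * C) fun m => ?_
  obtain ⟨y, hy₁, hy₂⟩ := hext (s ^ m * f * (s ^ m)⁻¹)
    ⟨(hf₁.conj _).isContractingElement hm₁, (hf₂.conj _).isContractingElement hm₂⟩
  obtain ⟨n, hn₁, hn₂⟩ := ((hE₁ m _ _ hx₁ hy₁).and (hE₂ m _ _ hx₂ hy₂)).exists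
  have c1 := abs_le.1 (hC _ (x n).2)
  have c2 := abs_le.1 (hC _ (y n).2)
  have c3 := abs_le.1 (hC _ (H.mul_mem (H.inv_mem (x n).2) (y n).2))
  have e1 : dist o₁ (((x n : G)⁻¹ * (y n : G)) • o₁) = dist (x n • o₁) (y n • o₁) := by
    rw [mul_smul, dist_comm, dist_inv_smul, dist_comm]
    rfl
  have e2 : dist o₂ (((x n : G)⁻¹ * (y n : G)) • o₂) = dist (x n • o₂) (y n • o₂) := by
    rw [mul_smul, dist_comm, dist_inv_smul, dist_comm]
    rfl
  rw [e1, e2] at c3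
  simp only [Subgroup.smul_def] at c3 hn₁ hn₂
  rw [abs_le] at hn₁ hn₂ ⊢
  constructor <;> linarith [dist_nonneg (x := o₁) (y := s ^ m • o₁), c1.1, c1.2, c2.1, c2.2]

end Rigidity

end MLSR

theorem theorem1p8 {G : Type*} [Group G]
    {X₁ : Type*} [MetricSpace X₁] [ProperSpace X₁] [MulAction G X₁] [IsIsometricSMul G X₁]
    {X₂ : Type*} [MetricSpace X₂] [ProperSpace X₂] [MulAction G X₂] [IsIsometricSMul G X₂]
    (hX₁ : MLSR.IsGeodesicSpace X₁) (hX₂ : MLSR.IsGeodesicSpace X₂)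
    (o₁ : X₁) (o₂ : X₂)
    (hG₁ : MLSR.HasContractingProperty G o₁) (hG₂ : MLSR.HasContractingProperty G o₂)
    (H : Subgroup G)
    (hdense : MLSR.GeometricallyDense o₁ o₂ H)
    (hH₁ : MLSR.HasContractingProperty H o₁) (hH₂ : MLSR.HasContractingProperty H o₂)
    (hext : MLSR.ExtensionCondition o₁ o₂ H) :
    MLSR.MLSRigidityFrom o₁ o₂ (H : Set G) := by
  intro hlen
  have : IsIsometricSMul H X₁ := ⟨fun h => isometry_smul X₁ (h : G)⟩
  have : IsIsometricSMul H X₂ := ⟨fun h => isometry_smul X₂ (h : G)⟩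
  obtain ⟨C, hC⟩ := MLSR.exists_abs_dist_sub_le hX₁ hX₂ hH₁ hH₂ fun t _ _ _ _ _ _ => hlen t t.2
  obtain ⟨C', hC'⟩ := MLSR.exists_abs_dist_sub_le hX₁ hX₂ hG₁ hG₂ fun t _ _ hl₁ hl₂ ht₁ ht₂ =>
    hext.stableLength_eq hX₁ hX₂ hG₁ hG₂ (fun h hh => hC ⟨h, hh⟩) hl₁ hl₂ ht₁ ht₂
  refine ⟨C', fun g h => ?_⟩
  have e := hC' (g⁻¹ * h)
  rwa [mul_smul, mul_smul, dist_comm, MLSR.dist_inv_smul, dist_comm, dist_comm o₂,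
    MLSR.dist_inv_smul, dist_comm _ (g • o₂)] at e
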